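/- Let $P$ be a finite unit interval order (a finite poset that is $(2+2)$-free and $(3+1)$-free), with underlying set $V$, and let $G$ be its incomparability graph. Fix a total order $<$ on $V$ that is a natural labelling of $P$: $u<_P w$ implies $u<w$, and if $u<_P w$ and $v$ is incomparable in $P$ to both $u$ and $w$, then $u<v<w$. Let $$\overline{X}_G(q)=\sum_{\kappa} q^{\mathrm{asc}(\kappa)}\prod_{v\in V}\prod_{i\in\kappa(v)}x_i ,$$ where $\kappa$ runs over the proper set colorings of $G$ (each vertex $v$ gets a nonempty finite set $\kappa(v)$ of positive integers, adjacent vertices get disjoint sets) and $\mathrm{asc}(\kappa)$ is the number of $(u,v,i,j)$ with $u,v$ adjacent in $G$, $u<v$, $i\in\kappa(u)$, $j\in\kappa(v)$ and $i<j$. Define $\overline{p}'_k$ by $1+\overline{p}'_k=\prod_{i\ge1}\frac{1}{1-x_i^k}$, and $\overline{p}'_\lambda=\prod_{i=1}^{\ell(\lambda)}\overline{p}'_{\lambda_i}$ for a partition $\lambda$; let $z_\lambda=\prod_{k\ge 1}k^{i_k}\,i_k!$, with $i_k$ the multiplicity of $k$ in $\lambda$. A heap on $G$ is an equivalence class of words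 in the alphabet $V$ under exchanging neighbouring letters that are not adjacent in $G$. Its pieces are the letters; two pieces are joined by an edge, directed from the earlier to the later one, if their vertices are equal or adjacent in $G$. A pyramid is a heap with a unique source (a piece with no edge directed towards it). Let $\mathcal{P}_G^{\text{all }V}(\lambda)$ be the set of lists $P=(P_1,\dots,P_{\ell(\lambda)})$ of pyramids such that $P_i$ has $\lambda_i$ pieces and each vertex of $G$ occurs in some $P_i$, and let $\mathrm{asc}(P)$ be the number of directed edges of the composite heap $P_1\circ\dots\circ P_{\ell(\lambda)}$ that go from a piece of a vertex $u$ to a piece of a vertex $v$ with $u<v$. Then, as formal power series in $x_1,x_2,\dots$ over $\mathbb{Q}[q]$, $$\overline{X}_G(q)=\sum_\lambda\frac{(-1)^{|\lambda|-\ell(\lambda)}}{z_\lambda}\sum_{P\in\mathcal{P}_G^{\text{all }V}(\lambda)}q^{\mathrm{asc}(P)}\prod_{i=1}^{\ell(\lambda)}\sum_{d\ge1}\frac{\mu(d)}{d}\ln\left(1+\overline{p}'_{d\lambda_i}\right),$$ where $\lambda$ runs over all partitions. Moreover, $\overline{X}_G(q)$ has a unique expansion $\sum_\lambda c_\lambda\,\overline{p}'_\lambda$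 with $c_\lambda\in\mathbb{Q}[q]$, and its coefficients are $$[\overline{p}'_\lambda]\overline{X}_G(q)=\sum_{(d\lambda')^n=\lambda}\frac{(-1)^{|\lambda'|-\ell(\lambda')}}{z_{\lambda'}}\sum_{P\in\mathcal{P}_G^{\text{all }V}(\lambda')}q^{\mathrm{asc}(P)}\prod_{i=1}^{\ell(\lambda')}\frac{\mu(d_i)(-1)^{n_i+1}}{d_in_i},$$ where the sum is over all partitions $\lambda'$ and all $d,n\in\mathbb{Z}_{>0}^{\ell(\lambda')}$ such that $\lambda$ is the partition $(d\lambda')^n$ whose parts are the $d_i\lambda'_i$, each repeated $n_i$ times. -/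

import Mathlib

open scoped MvPowerSeries.WithPiTopology

namespace Kromatic

/-! ### Posets, incomparability graphs and unit interval orders -/

section Posets

variable {V : Type*}

/-- The incomparability graph of the partial order `r` (read `r u v` as `u ≤ v`). -/
def incompGraph (r : V → V → Prop) [IsPartialOrder V r] : SimpleGraph V where
  Adj u v := IncompRel r u v
  symm := ⟨fun _ _ h => ⟨h.2, h.1⟩⟩
  loopless := ⟨fun v h => h.1 (refl_of r v)⟩

/-- The strict order that belongs to the partial order `r`. -/
def Prec (r : V → V → Prop) (u v : V) : Prop := r u v ∧ u ≠ v

/-- `r` is `(a+b)`-free: there are no two chains with `a` and `b` elements such that every element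
of the first is incomparable to every element of the second. -/
def IsFree (r : V → V → Prop) (a b : ℕ) : Prop :=
  ¬ ∃ (f : Fin a → V) (g : Fin b → V),
    (∀ i j, i < j → Prec r (f i) (f j)) ∧ (∀ i j, i < j → Prec r (g i) (g j)) ∧
      ∀ i j, IncompRel r (f i) (g j)

/-- A unit interval order is a poset that is `(2+2)`-free and `(3+1)`-free. -/
def IsUnitIntervalOrder (r : V → V → Prop) : Prop := IsFree r 2 2 ∧ IsFree r 3 1

/-- The total order on `V` is a natural labelling of the unit interval order `r`, i.e. it lists the
unit intervals from left to right: it extends `r`, and an element that is incomparable to both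
members of a relation `u ≺ w` lies between `u` and `w`. -/
def IsNaturalLabelling [LinearOrder V] (r : V → V → Prop) : Prop :=
  (∀ u w, Prec r u w → u < w) ∧
    ∀ u v w, Prec r u w → IncompRel r u v → IncompRel r v w → u < v ∧ v < w

end Posets

/-! ### Formal power series in `x_0, x_1, …` over `ℚ[q]` -/

/-- The coefficient ring `ℚ[q]`. -/
abbrev Coeff : Type := Polynomial ℚ

/-- The coefficients carry the discrete topology, so that infinite sums and products of power series
are the formal ones: each coefficient becomes stationary. -/
instance instTopologicalSpaceCoeff : TopologicalSpace Coeff := ⊥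

instance instDiscreteTopologyCoeff : DiscreteTopology Coeff := ⟨rfl⟩

/-- The ring of formal power series in countably many variables over `ℚ[q]`. -/
abbrev Series : Type := MvPowerSeries ℕ Coeff

/-- The geometric series `1 + x_i^k + x_i^{2k} + ⋯ = 1 / (1 - x_i^k)`. -/
noncomputable def geom (k : ℕ+) (i : ℕ) : Series :=
  ∑' n : ℕ, ((MvPowerSeries.X i : Series) ^ (k : ℕ)) ^ n

/-- `p̄'_k`, where `1 + p̄'_k = ∏_i 1 / (1 - x_i^k)`. -/
noncomputable def pbar (k : ℕ+) : Series := (∏' i : ℕ, geom k i) - 1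

/-- `ln (1 + p̄'_k)`. -/
noncomputable def logPbar (k : ℕ+) : Series := (PowerSeries.log Coeff).subst (pbar k)

/-- `∑_{d ≥ 1} (μ(d) / d) ln (1 + p̄'_{dk})`. -/
noncomputable def moebiusLog (k : ℕ+) : Series :=
  ∑' d : ℕ+, ((ArithmeticFunction.moebius (d : ℕ) : ℚ) / (d : ℕ)) • logPbar (d * k)

/-! ### Integer partitions -/

/-- An integer partition: a weakly decreasing list of positive integers. -/
@[ext]
structure IntPartition where
  parts : List ℕ+
  sorted : parts.Pairwise (· ≥ ·)

namespace IntPartition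

/-- `ℓ(λ)`, the number of parts. -/
def length (l : IntPartition) : ℕ := l.parts.length

/-- `λ_i`. -/
def part (l : IntPartition) (i : Fin l.length) : ℕ+ := l.parts.get i

/-- `|λ|`, the sum of the parts. -/
def size (l : IntPartition) : ℕ := ∑ i, (l.part i : ℕ)

/-- `z_λ = ∏_k k^{i_k} i_k!` with `i_k` the multiplicity of the part `k`. -/
def z (l : IntPartition) : ℕ :=
  ∏ k ∈ l.parts.toFinset, (k : ℕ) ^ l.parts.count k * (l.parts.count k).factorial

/-- `(-1)^{|λ| - ℓ(λ)} / z_λ` (and `ℓ(λ) ≤ |λ|`, as the parts are positive). -/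
def signedWeight (l : IntPartition) : ℚ := (-1) ^ (l.size - l.length) / l.z

/-- `p̄'_λ = p̄'_{λ_1} p̄'_{λ_2} ⋯`. -/
noncomputable def pbar (l : IntPartition) : Series := ∏ i, Kromatic.pbar (l.part i)

end IntPartition

/-- A partition `λ'` with two sequences `d`, `n` of `ℓ(λ')` positive integers. -/
structure Blowup where
  base : IntPartition
  d : Fin base.length → ℕ+
  n : Fin base.length → ℕ+

namespace Blowup

/-- The list in which `d_i λ'_i` is repeated `n_i` times for each `i`; rearranged in weakly
decreasing order it is the partition `(dλ')^n`. -/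
def list (t : Blowup) : List ℕ+ :=
  (List.ofFn fun i => List.replicate (t.n i) (t.d i * t.base.part i)).flatten

/-- `∏_i μ(d_i) (-1)^{n_i + 1} / (d_i n_i)`. -/
noncomputable def weight (t : Blowup) : ℚ :=
  ∏ i, (ArithmeticFunction.moebius (t.d i : ℕ) : ℚ) * (-1) ^ ((t.n i : ℕ) + 1) /
    ((t.d i : ℕ) * (t.n i : ℕ))

/-- All `(λ', d, n)` with `(dλ')^n = λ`. -/
def fiber (l : IntPartition) : Set Blowup := {t | t.list.Perm l.parts}

end Blowup

/-! ### Set colourings and the Kromatic quasisymmetric function -/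

section Colourings

variable {V : Type*} [Fintype V] [LinearOrder V]

/-- Proper set colourings: every vertex gets a nonempty finite set of colours, and adjacent vertices
get disjoint sets. (Infinite sets of colours have no monomial.) -/
def SetColouring (G : SimpleGraph V) : Type _ :=
  {κ : V → Finset ℕ // (∀ v, (κ v).Nonempty) ∧ ∀ u v, G.Adj u v → Disjoint (κ u) (κ v)}

open Classical in
/-- The number of `(u, v, i, j)` with `u, v` adjacent, `u < v`, `i ∈ κ u`, `j ∈ κ v`, `i < j`. -/
noncomputable def SetColouring.asc {G : SimpleGraph V} (κ : SetColouring G) : ℕ :=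
  ∑ e : V × V with G.Adj e.1 e.2 ∧ e.1 < e.2,
    ((κ.1 e.1 ×ˢ κ.1 e.2).filter fun c => c.1 < c.2).card

/-- The term `q^{asc κ} ∏_v ∏_{i ∈ κ v} x_i`. -/
noncomputable def SetColouring.term {G : SimpleGraph V} (κ : SetColouring G) : Series :=
  ((Polynomial.X : Coeff) ^ κ.asc) • ∏ v, ∏ i ∈ κ.1 v, (MvPowerSeries.X i : Series)

/-- The Kromatic quasisymmetric function `X̄_G(q)`. -/
noncomputable def kromaticQ (G : SimpleGraph V) : Series := ∑' κ : SetColouring G, κ.term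

end Colourings

/-! ### Heaps -/

section Heaps

variable {V : Type*}

/-- Letters that are not adjacent in `G` commute. -/
inductive CommRel (G : SimpleGraph V) : FreeMonoid V → FreeMonoid V → Prop
  | swap (u v : V) (h : ¬ G.Adj u v) :
      CommRel G (FreeMonoid.of u * FreeMonoid.of v) (FreeMonoid.of v * FreeMonoid.of u)

/-- Heaps on `G`, as the free partially commutative monoid on `V`: words in the vertices up to
exchanging neighbouring letters that are not adjacent in `G`. The pieces are the letters of a word;
two pieces are joined by an edge if their vertices are equal or adjacent, and the edge is directed
from the earlier to the later piece. -/
abbrev Heap (G : SimpleGraph V) : Type _ := PresentedMonoid (CommRel G)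

/-- The heap of a word. -/
def Heap.ofWord (G : SimpleGraph V) (w : List V) : Heap G :=
  PresentedMonoid.mk (CommRel G) (FreeMonoid.ofList w)

/-- The type of a heap: the multiset of the vertices of its pieces. -/
def Heap.type {G : SimpleGraph V} (H : Heap G) : Multiset V :=
  Multiplicative.toAdd (PresentedMonoid.lift (rels := CommRel G)
    (fun v => Multiplicative.ofAdd ({v} : Multiset V))
    (by rintro _ _ ⟨u, v, _⟩; simp [mul_comm]) H)

/-- The number of pieces. -/
def Heap.size {G : SimpleGraph V} (H : Heap G) : ℕ := Multiset.card H.type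

/-- The `j`-th letter of the word is a source: no earlier piece is joined to it by an edge. -/
def IsSource (G : SimpleGraph V) (w : List V) (j : Fin w.length) : Prop :=
  ∀ i < j, ¬ (w.get i = w.get j ∨ G.Adj (w.get i) (w.get j))

/-- A pyramid is a heap with a unique source. (The sources do not depend on the word.) -/
def Heap.IsPyramid {G : SimpleGraph V} (H : Heap G) : Prop :=
  ∃ w : List V, Heap.ofWord G w = H ∧ ∃! j, IsSource G w j

variable [LinearOrder V]

open Classical in
/-- The number of pairs of an earlier letter `u` and a later letter `v` with `u, v` adjacent in `G`
and `u < v`. -/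
noncomputable def wordAsc (G : SimpleGraph V) : List V → ℕ
  | [] => 0
  | u :: w => w.countP (fun v => G.Adj u v ∧ u < v) + wordAsc G w

open Classical in
theorem wordAsc_append (G : SimpleGraph V) (a b : List V) :
    wordAsc G (a ++ b) = wordAsc G a + wordAsc G b +
      (a.map fun u => b.countP (fun v => G.Adj u v ∧ u < v)).sum := by
  induction a with
  | nil => simp [wordAsc]
  | cons u a ih => simp only [List.cons_append, wordAsc, ih, List.countP_append, List.map_cons,
      List.sum_cons]; omega

/-- Words with the same letters and the same number of ascents. -/
def ascCon (G : SimpleGraph V) : Con (FreeMonoid V) where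
  r a b := a.toList.Perm b.toList ∧ wordAsc G a.toList = wordAsc G b.toList
  iseqv := ⟨fun _ => ⟨.refl _, rfl⟩, fun h => ⟨h.1.symm, h.2.symm⟩,
    fun h h' => ⟨h.1.trans h'.1, h.2.trans h'.2⟩⟩
  mul' := by
    classical
    rintro a b c d ⟨h1, h2⟩ ⟨h3, h4⟩
    refine ⟨by simpa using h1.append h3, ?_⟩
    simp only [FreeMonoid.toList_mul, wordAsc_append, h2, h4]
    congr 1
    simp only [fun u => h3.countP_eq (fun v => decide (G.Adj u v ∧ u < v))]
    exact (h1.map _).sum_eq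

/-- The number of ascents of a heap: directed edges `u → v` of the heap between pieces of distinct
vertices with `u < v`. -/
noncomputable def Heap.asc {G : SimpleGraph V} (H : Heap G) : ℕ :=
  Quotient.lift (s := (conGen (CommRel G)).toSetoid) (fun w => wordAsc G (FreeMonoid.toList w))
    (fun a b h => by
      have hle : conGen (CommRel G) ≤ ascCon G := by
        refine Con.conGen_le.2 ?_
        rintro _ _ ⟨u, v, h⟩
        have h' : ¬ G.Adj v u := fun e => h e.symm
        exact ⟨by simpa using List.Perm.swap v u [], by simp [wordAsc, h, h']⟩
      exact (hle h).2) H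

/-- `𝒫_G^{all V}(λ)`: the lists `(P_1, …, P_ℓ)` of pyramids with `|P_i| = λ_i` such that every vertex
of `G` occurs in some `P_i`. -/
def pyramidLists (G : SimpleGraph V) (l : IntPartition) : Set (Fin l.length → Heap G) :=
  {P | (∀ i, (P i).IsPyramid ∧ (P i).size = l.part i) ∧ ∀ v, ∃ i, v ∈ (P i).type}

/-- `asc P`, the number of ascents of the heap `P_1 ∘ P_2 ∘ ⋯ ∘ P_ℓ`. -/
noncomputable def listAsc {G : SimpleGraph V} {m : ℕ} (P : Fin m → Heap G) : ℕ :=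
  Heap.asc (List.ofFn P).prod

/-- `∑_{P ∈ 𝒫_G^{all V}(λ)} q^{asc P}`, a finite sum. -/
noncomputable def pyramidPoly (G : SimpleGraph V) (l : IntPartition) : Coeff :=
  ∑ᶠ P ∈ pyramidLists G l, Polynomial.X ^ listAsc P

end Heaps

/-! ### The infinite sums and products above converge, and the index sets are finite -/

theorem constantCoeff_X_pow (k : ℕ+) (i : ℕ) :
    MvPowerSeries.constantCoeff ((MvPowerSeries.X i : Series) ^ (k : ℕ)) = 0 := by
  simp [k.pos.ne']

theorem summable_geom (k : ℕ+) (i : ℕ) :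
    Summable fun n : ℕ => ((MvPowerSeries.X i : Series) ^ (k : ℕ)) ^ n :=
  MvPowerSeries.WithPiTopology.summable_pow_of_constantCoeff_eq_zero (constantCoeff_X_pow k i)

theorem geom_eq (k : ℕ+) (i : ℕ) :
    geom k i = 1 + (MvPowerSeries.X i : Series) ^ (k : ℕ) * geom k i := by
  have h := MvPowerSeries.WithPiTopology.one_sub_mul_tsum_pow_of_constantCoeff_eq_zero
    (constantCoeff_X_pow k i)
  change (1 - _) * geom k i = 1 at h
  linear_combination h

theorem coeff_prod_eq_zero (k : ℕ+) (s : Finset ℕ) (m : ℕ →₀ ℕ) {i : ℕ} (hi : i ∈ s)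
    (hm : m i < k) :
    MvPowerSeries.coeff m (∏ i ∈ s, (MvPowerSeries.X i : Series) ^ (k : ℕ) * geom k i) = 0 := by
  have h : (MvPowerSeries.X i : Series) ^ (k : ℕ) ∣
      ∏ i ∈ s, (MvPowerSeries.X i : Series) ^ (k : ℕ) * geom k i :=
    (dvd_mul_right _ _).trans (Finset.dvd_prod_of_mem _ hi)
  exact MvPowerSeries.X_pow_dvd_iff.1 h m hm

theorem summable_prod_geom (k : ℕ+) :
    Summable fun s : Finset ℕ => ∏ i ∈ s, (MvPowerSeries.X i : Series) ^ (k : ℕ) * geom k i := by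
  refine MvPowerSeries.WithPiTopology.summable_iff_summable_coeff.2 fun m =>
    summable_of_hasFiniteSupport ((m.support.powerset.finite_toSet).subset fun s hs => ?_)
  simp only [Finset.coe_powerset, Set.mem_preimage, Set.mem_powerset_iff, Finset.coe_subset]
  intro i hi
  by_contra h
  exact hs (coeff_prod_eq_zero k s m hi (by simp at h; simp [h]))

/-- The product that defines `p̄'_k` converges. -/
theorem multipliable_geom (k : ℕ+) : Multipliable fun i : ℕ => geom k i := by
  have h := multipliable_one_add_of_summable_prod (summable_prod_geom k)
  simpa only [← geom_eq] using h

theorem le_order_pbar (k : ℕ+) : ((k : ℕ) : ℕ∞) ≤ MvPowerSeries.order (pbar k) := by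
  refine MvPowerSeries.le_order fun m hm => ?_
  have hm' : m.degree < (k : ℕ) := by exact_mod_cast hm
  have h1 : (∏' i : ℕ, geom k i) =
      ∑' s : Finset ℕ, ∏ i ∈ s, (MvPowerSeries.X i : Series) ^ (k : ℕ) * geom k i := by
    rw [← tprod_one_add (summable_prod_geom k)]
    simp only [← geom_eq]
  have h2 := (summable_prod_geom k).map_tsum (MvPowerSeries.coeff (R := Coeff) m)
    (MvPowerSeries.WithPiTopology.continuous_coeff Coeff m)
  rw [pbar, map_sub, h1, h2, tsum_eq_single ∅, Finset.prod_empty, sub_self]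
  intro s hs
  obtain ⟨i, hi⟩ := Finset.nonempty_iff_ne_empty.2 hs
  exact coeff_prod_eq_zero k s m hi ((Finsupp.le_degree i m).trans_lt hm')

theorem constantCoeff_pbar (k : ℕ+) : MvPowerSeries.constantCoeff (pbar k) = 0 := by
  refine MvPowerSeries.coeff_of_lt_order (d := 0) (lt_of_lt_of_le ?_ (le_order_pbar k))
  simp

/-- `p̄'_k` may be substituted into `log (1 + X)`. -/
theorem hasSubst_pbar (k : ℕ+) : PowerSeries.HasSubst (pbar k) :=
  PowerSeries.HasSubst.of_constantCoeff_zero (constantCoeff_pbar k)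

/-- The sum that defines `moebiusLog` converges. -/
theorem summable_moebiusLog (k : ℕ+) : Summable fun d : ℕ+ =>
    ((ArithmeticFunction.moebius (d : ℕ) : ℚ) / (d : ℕ)) • logPbar (d * k) := by
  refine MvPowerSeries.WithPiTopology.summable_iff_summable_coeff.2 fun m =>
    summable_of_hasFiniteSupport (((Set.finite_Iic m.degree).preimage
      (PNat.coe_injective.injOn)).subset fun d hd => ?_)
  by_contra h
  simp only [Set.mem_preimage, Set.mem_Iic, not_le] at h
  refine hd ?_
  have h0 : MvPowerSeries.coeff m (logPbar (d * k)) = 0 := by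
    refine MvPowerSeries.coeff_of_lt_order (lt_of_lt_of_le ?_ ((le_order_pbar (d * k)).trans
      (PowerSeries.le_order_subst_right (constantCoeff_pbar _) PowerSeries.constantCoeff_log)))
    have : (d : ℕ) ≤ ((d * k : ℕ+) : ℕ) := by
      rw [PNat.mul_coe]; exact Nat.le_mul_of_pos_right _ k.pos
    exact_mod_cast h.trans_le this
  change MvPowerSeries.coeff m (_ • _) = 0
  rw [show ∀ (a : ℚ) (f : Series), MvPowerSeries.coeff m (a • f) = a • MvPowerSeries.coeff m f
    from fun _ _ => rfl, h0, smul_zero]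

/-- The sum that defines `X̄_G(q)` converges. -/
theorem SetColouring.summable_term {V : Type*} [Fintype V] [LinearOrder V] (G : SimpleGraph V) :
    Summable fun κ : SetColouring G => κ.term := by
  have hd : ∀ (κ : SetColouring G) (v : V), ∀ i ∈ κ.1 v, (MvPowerSeries.X i : Series) ∣ κ.term := by
    intro κ v i hi
    rw [SetColouring.term, MvPowerSeries.smul_eq_C_mul]
    exact ((Finset.dvd_prod_of_mem _ hi).trans
      (Finset.dvd_prod_of_mem (fun v => ∏ i ∈ κ.1 v, (MvPowerSeries.X i : Series))
        (Finset.mem_univ v))).mul_left _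
  refine MvPowerSeries.WithPiTopology.summable_iff_summable_coeff.2 fun m =>
    summable_of_hasFiniteSupport ?_
  have hfin : {κ : V → Finset ℕ | ∀ v, κ v ∈ m.support.powerset}.Finite :=
    Set.Finite.pi' fun v => m.support.powerset.finite_toSet
  refine (hfin.preimage (Subtype.val_injective.injOn)).subset fun κ hκ v => ?_
  rw [Finset.mem_powerset]
  intro i hi
  by_contra h
  exact hκ (MvPowerSeries.X_dvd_iff.1 (hd κ v i hi) m (by simpa using h))

theorem Heap.type_ofWord {V : Type*} (G : SimpleGraph V) (w : List V) :
    (Heap.ofWord G w).type = (w : Multiset V) := by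
  induction w with
  | nil => rfl
  | cons u w ih =>
    have h : Heap.ofWord G (u :: w) = PresentedMonoid.of (CommRel G) u * Heap.ofWord G w := rfl
    have h2 : (Heap.ofWord G (u :: w)).type = {u} + (Heap.ofWord G w).type := by
      rw [h, Heap.type, map_mul, toAdd_mul, PresentedMonoid.lift_of]; rfl
    rw [h2, ih]; rfl

/-- `𝒫_G^{all V}(λ)` is finite. -/
theorem pyramidLists_finite {V : Type*} [Fintype V] (G : SimpleGraph V) (l : IntPartition) :
    (pyramidLists G l).Finite := by
  have hfin : ∀ n : ℕ, {H : Heap G | H.size = n}.Finite := fun n => by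
    refine ((List.finite_length_eq V n).image (Heap.ofWord G)).subset fun H hH => ?_
    obtain ⟨w, rfl⟩ := PresentedMonoid.surjective_mk H
    refine ⟨w.toList, ?_, rfl⟩
    have h := Heap.type_ofWord G w.toList
    have h2 : Multiset.card (Heap.ofWord G w.toList).type = n := hH
    rw [h] at h2
    simpa using h2
  exact (Set.Finite.pi' fun i => hfin (l.part i)).subset fun P hP i => (hP.1 i).2

/-- There are finitely many `(λ', d, n)` with `(dλ')^n = λ`. -/
theorem Blowup.fiber_finite (l : IntPartition) : (Blowup.fiber l).Finite := by
  let code : Blowup → List (ℕ+ × ℕ+ × ℕ+) := fun t => List.ofFn fun i => (t.base.part i, t.d i, t.n i)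
  have hinj : Function.Injective code := by
    rintro ⟨b, d, n⟩ ⟨b', d', n'⟩ h
    have hb : ∀ t : Blowup, (code t).map Prod.fst = t.base.parts := fun t => by
      simp only [code, List.map_ofFn]; exact List.ofFn_get _
    obtain rfl : b = b' := IntPartition.ext (by
      rw [← hb ⟨b, d, n⟩, ← hb ⟨b', d', n'⟩, h])
    have h' := List.ofFn_injective h
    have hd : d = d' := funext fun i => congrArg (fun x => x.2.1) (congrFun h' i)
    have hn : n = n' := funext fun i => congrArg (fun x => x.2.2) (congrFun h' i)
    rw [hd, hn]
  let M : ℕ+ := l.parts.foldr max 1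
  have hM : ∀ x ∈ l.parts, x ≤ M := fun x hx => List.le_max_of_le' 1 hx le_rfl
  let K : ℕ+ := l.parts.length.succPNat
  have hfin : ((List.map fun x : Set.Iic M × Set.Iic M × Set.Iic K =>
      ((x.1 : ℕ+), (x.2.1 : ℕ+), (x.2.2 : ℕ+))) '' {L | L.length ≤ l.parts.length}).Finite :=
    (List.finite_length_le _ _).image _
  refine (hfin.preimage hinj.injOn).subset fun t ht => ?_
  have ht' : t.list.Perm l.parts := ht
  have hlen : ∑ i, (t.n i : ℕ) = l.parts.length := by
    rw [← ht'.length_eq]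
    simp [Blowup.list, List.length_flatten, List.map_ofFn, List.sum_ofFn, Function.comp_def]
  have hmem : ∀ i, t.d i * t.base.part i ≤ M := fun i => hM _ (ht'.mem_iff.1 (by
    simp only [Blowup.list, List.mem_flatten, List.mem_ofFn]
    exact ⟨_, ⟨i, rfl⟩, by simp⟩))
  have hn : ∀ i, t.n i ≤ K := fun i => by
    have h1 : (t.n i : ℕ) ≤ ∑ i, (t.n i : ℕ) :=
      Finset.single_le_sum (f := fun i => (t.n i : ℕ)) (fun _ _ => Nat.zero_le _)
        (Finset.mem_univ i)
    rw [← PNat.coe_le_coe, Nat.succPNat_coe]; omega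
  have hd : ∀ i, t.d i ≤ M := fun i => le_trans (by
    rw [← PNat.coe_le_coe, PNat.mul_coe]; exact Nat.le_mul_of_pos_right _ (PNat.pos _)) (hmem i)
  have hp : ∀ i, t.base.part i ≤ M := fun i => le_trans (by
    rw [← PNat.coe_le_coe, PNat.mul_coe]; exact Nat.le_mul_of_pos_left _ (PNat.pos _)) (hmem i)
  refine ⟨List.ofFn fun i => (⟨_, hp i⟩, ⟨_, hd i⟩, ⟨_, hn i⟩), ?_, ?_⟩
  · simp only [Set.mem_ofPred_eq, List.length_ofFn, ← hlen]
    calc t.base.length = ∑ _i : Fin t.base.length, 1 := by simp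
      _ ≤ _ := Finset.sum_le_sum fun i _ => (t.n i).pos
  · simp only [List.map_ofFn]; rfl

end Kromatic

/-! Let e_k and π_k be the sums of the stable sets with k elements (as heaps) and of the pyramids
with k pieces. They satisfy Newton's identity n e_n = ∑_{k ≥ 1} (-1)^{k+1} π_k e_{n-k} in every ring
to which heaps are mapped multiplicatively, commutative or not (`natCast_mul_stableSum`): on pairs
of a pyramid and a stable set, moving a vertex from the set to the end of the pyramid or back
reverses the sign, and the pairs without a movable vertex are pointed stable sets.

The number of ascents is not additive on heaps, so q^asc is not multiplicative. The computation
therefore takes place in the monoid algebra of words modulo equality of letters and ascents, and a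
linear functional sends a heap containing every vertex to q^asc only at the end. The colour classes
of a set colouring are stable sets that cover V, and its ascents are those of their composite in the
order of the colours; hence the coefficient of x^m in the Kromatic function is the functional at
e_{m_0} e_{m_1} ⋯ (`coeff_kromaticQ`).

In this algebra the e_k commute (`commute_stableSum`). For two stable sets, a natural labelling
allows each vertex at most one larger and at most one smaller neighbour in the other set. In a
connected component of their union where the two sets have different sizes, this forces equally many
ascents in both directions, so exchanging the sets on precisely those components exchanges the total
sizes and keeps the ascents. By Newton's identity the π_k lie in the commutative algebra generated
by the e_k, and the classical expansion of elementary into power sums applies, with π_k in the role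
of the power sums (`prod_eq_sum_mparts`).

Finally ln(1 + p̄'_k) = ∑_j p_{kj} / j (`logPbar_eq`), and Möbius inversion turns the sum over d
into the power sum p_k (`moebiusLog_eq`). This gives the first formula. Expanding the logarithms
again and collecting equal partitions gives the second one (`Blowup.hasSum_pbar`); its coefficients
are unique because the p̄'_λ are triangular with respect to monomials (`hasSum_pbar_unique`). -/

namespace Kromatic

/-! ### Right recursion on heaps -/

namespace Heap

variable {V : Type*} {G : SimpleGraph V}

/-- The heap with the single piece `v`. -/
def piece (G : SimpleGraph V) (v : V) : Heap G := PresentedMonoid.of (CommRel G) v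

theorem piece_comm {u v : V} (h : ¬ G.Adj u v) : piece G u * piece G v = piece G v * piece G u :=
  PresentedMonoid.mk_eq_mk_of_rel (CommRel.swap u v h)

theorem ofWord_append (a b : List V) : ofWord G (a ++ b) = ofWord G a * ofWord G b := rfl

theorem ofWord_nil : ofWord G [] = 1 := rfl

theorem ofWord_cons (v : V) (a : List V) : ofWord G (v :: a) = piece G v * ofWord G a := rfl

theorem ofWord_concat (a : List V) (v : V) : ofWord G (a ++ [v]) = ofWord G a * piece G v := rfl

theorem exists_word (H : Heap G) : ∃ w, ofWord G w = H := by
  obtain ⟨w, rfl⟩ := PresentedMonoid.surjective_mk H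
  exact ⟨w.toList, rfl⟩

theorem induction_right {motive : Heap G → Prop} (one : motive 1)
    (mul : ∀ H v, motive H → motive (H * piece G v)) (H : Heap G) : motive H := by
  obtain ⟨w, rfl⟩ := exists_word H
  induction w using List.reverseRecOn with
  | nil => exact one
  | append_singleton a v ih => exact mul _ v ih

theorem eq_one_or_eq_mul (H : Heap G) : H = 1 ∨ ∃ H' v, H = H' * piece G v := by
  induction H using induction_right with
  | one => exact .inl rfl
  | mul H v _ => exact .inr ⟨H, v, rfl⟩

section Recursion

variable {X : Type*} (x : X) (f : X → V → X)
  (hf : ∀ x u v, ¬ G.Adj u v → f (f x u) v = f (f x v) u)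

/-- Define a function on heaps by adding the pieces one by one. -/
def foldl : Heap G → X := fun H =>
  -- Endomorphisms compose from right to left; the opposite monoid lets the first letter act first.
  (PresentedMonoid.lift (rels := CommRel G) (M := (Function.End X)ᵐᵒᵖ)
    (fun v => MulOpposite.op fun x => f x v)
    (by
      rintro _ _ ⟨u, v, h⟩
      simp only [map_mul, FreeMonoid.lift_eval_of]
      exact congrArg MulOpposite.op (funext fun x => hf x u v h)) H).unop x

theorem foldl_one : foldl x f hf 1 = x := rfl

theorem foldl_mul_piece (H : Heap G) (v : V) :
    foldl x f hf (H * piece G v) = f (foldl x f hf H) v := by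
  simp only [foldl, map_mul, MulOpposite.unop_mul]
  rfl

end Recursion

theorem type_one : (1 : Heap G).type = 0 := rfl

theorem type_mul (H K : Heap G) : (H * K).type = H.type + K.type := by
  simp [type]

theorem type_piece (v : V) : (piece G v).type = {v} := rfl

theorem size_one : (1 : Heap G).size = 0 := rfl

theorem size_mul (H K : Heap G) : (H * K).size = H.size + K.size := by
  simp [size, type_mul]

theorem size_piece (v : V) : (piece G v).size = 1 := rfl

theorem eq_one_of_size (H : Heap G) (h : H.size = 0) : H = 1 := by
  obtain rfl | ⟨H', v, rfl⟩ := H.eq_one_or_eq_mul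
  · rfl
  · simp [size_mul, size_piece] at h

theorem finite_size_le [Finite V] (n : ℕ) : {H : Heap G | H.size ≤ n}.Finite := by
  refine ((List.finite_length_le V n).image (ofWord G)).subset fun H hH => ?_
  obtain ⟨w, rfl⟩ := exists_word H
  refine ⟨w, ?_, rfl⟩
  simpa [size, type_ofWord] using hH

end Heap

/-- Pieces of `u` and `v` are joined by an edge. -/
def Touch {V : Type*} (G : SimpleGraph V) (u v : V) : Prop := u = v ∨ G.Adj u v

theorem Touch.symm {V : Type*} {G : SimpleGraph V} {u v : V} (h : Touch G u v) : Touch G v u :=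
  h.imp Eq.symm SimpleGraph.Adj.symm

/-! ### Sources of heaps and removal of final pieces -/

namespace Heap

variable {V : Type*} {G : SimpleGraph V}

open Classical in
/-- The number of sources of a heap. -/
noncomputable def sources (H : Heap G) : ℕ :=
  -- The state is the type of the heap built so far and its number of sources; a new piece is a
  -- source if it touches no earlier piece, which only the type has to tell.
  (foldl ((0 : Multiset V), 0)
    (fun x v => (x.1 + {v}, x.2 + if ∃ u ∈ x.1, Touch G u v then 0 else 1))
    (by
      intro x u v h
      rcases eq_or_ne u v with rfl | hne
      · rfl
      have h1 : ¬ Touch G u v := by rintro (h' | h') <;> tauto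
      have h2 : ¬ Touch G v u := fun h => h1 h.symm
      simp only [Multiset.mem_add, Multiset.mem_singleton, or_and_right, exists_or,
        exists_eq_left, h1, h2, or_false, Prod.mk.injEq]
      exact ⟨by rw [add_right_comm], by rw [add_right_comm]⟩) H).2

open Classical in
theorem sources_mul_piece (H : Heap G) (v : V) :
    (H * piece G v).sources =
      H.sources + if ∃ u ∈ H.type, Touch G u v then 0 else 1 := by
  unfold sources
  rw [foldl_mul_piece]
  have : ∀ (f : Multiset V × ℕ → V → ℕ) (hf) (K : Heap G),
      (foldl ((0 : Multiset V), 0) (fun x u => (x.1 + {u}, f x u)) hf K).1 = K.type := by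
    intro f hf K
    induction K using induction_right with
    | one => rfl
    | mul K v ih => rw [foldl_mul_piece, type_mul, type_piece, ih]
  simp only [this]

theorem sources_one : (1 : Heap G).sources = 0 := rfl

theorem sources_pos {H : Heap G} (h : H ≠ 1) : 0 < H.sources := by
  induction H using induction_right with
  | one => exact absurd rfl h
  | mul H v ih =>
    rw [sources_mul_piece]
    rcases eq_or_ne H 1 with rfl | hH
    · simp [type_one]
    · exact Nat.add_pos_left (ih hH) _

open Classical in
-- Whether a letter is a source depends only on the letters before it, so appending a letter changes
-- nothing at the earlier positions. The right-hand side sees only the heap, which shows that the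
-- count does not depend on the word.
theorem card_isSource (w : List V) :
    (Finset.univ.filter fun j => IsSource G w j).card = (ofWord G w).sources := by
  induction w using List.reverseRecOn with
  | nil => rfl
  | append_singleton a v ih =>
    rw [ofWord_concat, sources_mul_piece, ← ih, type_ofWord]
    simp only [Finset.card_filter]
    have hlen : (a ++ [v]).length = a.length + 1 := by simp
    rw [← (finCongr hlen.symm).sum_comp, Fin.sum_univ_castSucc]
    congr 1
    · refine Finset.sum_congr rfl fun i _ => if_congr ?_ rfl rfl
      simp only [IsSource]
      constructor
      · intro h j hj
        have := h (finCongr hlen.symm j.castSucc) (by simpa using hj)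
        simpa [List.getElem_append_left] using this
      · intro h j hj
        have hj' : (j : ℕ) < i := by simpa [Fin.lt_def] using hj
        have := h ⟨j, hj'.trans i.2⟩ hj'
        simpa [List.getElem_append_left, hj'.trans i.2] using this
    · rw [← ite_not (∃ u ∈ _, _)]
      refine if_congr ?_ rfl rfl
      simp only [IsSource, not_exists, not_and, Multiset.mem_coe]
      constructor
      · intro h u hu
        obtain ⟨j, hj, rfl⟩ := List.getElem_of_mem hu
        have := h (finCongr hlen.symm (Fin.castSucc ⟨j, hj⟩)) (by simp [Fin.lt_def, hj])
        simpa [List.getElem_append_left, hj, Touch] using this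
      · intro h j hj
        have hj' : (j : ℕ) < a.length := by simpa [Fin.lt_def] using hj
        have := h a[j] (List.getElem_mem hj')
        simpa [List.getElem_append_left, hj', Touch] using this

theorem isPyramid_iff (H : Heap G) : H.IsPyramid ↔ H.sources = 1 := by
  classical
  have key : ∀ w : List V, (∃! j, IsSource G w j) ↔ (ofWord G w).sources = 1 := fun w => by
    rw [← card_isSource, Finset.card_eq_one]
    simp [Finset.ext_iff, ExistsUnique]
    exact exists_congr fun a => ⟨fun h b => ⟨h.2 b, fun e => e ▸ h.1⟩,
      fun h => ⟨(h a).2 rfl, fun b => (h b).1⟩⟩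
  constructor
  · rintro ⟨w, rfl, h⟩
    exact (key w).1 h
  · intro h
    obtain ⟨w, rfl⟩ := exists_word H
    exact ⟨w, rfl, (key w).2 h⟩

theorem not_isPyramid_one : ¬ (1 : Heap G).IsPyramid := by
  simp [isPyramid_iff, sources_one]

theorem isPyramid_piece (v : V) : (piece G v).IsPyramid := by
  rw [isPyramid_iff, ← one_mul (piece G v), sources_mul_piece]
  simp [type_one, sources_one]

/-- A nonempty heap already has a source, so the added piece must not become another one. -/
theorem isPyramid_mul_piece {H : Heap G} {v : V} (hH : H ≠ 1) :
    (H * piece G v).IsPyramid ↔ H.IsPyramid ∧ ∃ u ∈ H.type, Touch G u v := by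
  have := sources_pos hH
  simp only [isPyramid_iff, sources_mul_piece]
  split_ifs with h
  · simp [h]
  · simp only [h, and_false, iff_false]; omega

open Classical in
/-- Remove a final piece `v` of a heap, if there is one. -/
noncomputable def pop (v : V) (H : Heap G) : Option (Heap G) :=
  (foldl ((1 : Heap G), (none : Option (Heap G)))
    -- The state is the heap so far and the same heap without its last `v`, as long as that `v` can
    -- be commuted to the end. A new `v` restarts the record, a neighbour of `v` blocks it, and any
    -- other letter is appended to it.
    (fun x u => (x.1 * piece G u, if u = v then some x.1 else if G.Adj u v then none else
      x.2.map (· * piece G u)))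
    (by
      intro x a b h
      rcases eq_or_ne a b with rfl | hne
      · rfl
      have h' : ¬ G.Adj b a := fun e => h e.symm
      refine Prod.ext (by simp only [mul_assoc, piece_comm h]) ?_
      dsimp only
      by_cases ha : a = v
      · subst ha
        simp [hne.symm, h']
      by_cases hb : b = v
      · subst hb
        simp [ha, h]
      simp only [ha, hb, if_false]
      split_ifs <;> simp [Function.comp_def, mul_assoc, piece_comm h]) H).2

open Classical in
theorem pop_mul_piece (v : V) (H : Heap G) (u : V) :
    pop v (H * piece G u) = if u = v then some H else if G.Adj u v then none else
      (pop v H).map (· * piece G u) := by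
  unfold pop
  rw [foldl_mul_piece]
  have : ∀ (f : Heap G × Option (Heap G) → V → Option (Heap G)) (hf) (K : Heap G),
      (foldl ((1 : Heap G), (none : Option (Heap G)))
        (fun x u => (x.1 * piece G u, f x u)) hf K).1 = K := by
    intro f hf K
    induction K using induction_right with
    | one => rfl
    | mul K v ih => rw [foldl_mul_piece]; dsimp only; rw [ih]
  simp only [this]

theorem pop_mul_self (v : V) (H : Heap G) : pop v (H * piece G v) = some H := by
  simp [pop_mul_piece]

/-- Removal is the partial inverse of right multiplication by a piece; in particular such
multiplication is cancellable. -/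
theorem pop_eq_some {v : V} {H K : Heap G} : pop v H = some K ↔ H = K * piece G v := by
  refine ⟨fun h => ?_, fun h => h ▸ pop_mul_self v K⟩
  induction H using induction_right generalizing K with
  | one => exact absurd h (by simp [pop, foldl_one])
  | mul H u ih =>
    rw [pop_mul_piece] at h
    split_ifs at h with h1 h2
    · obtain rfl : H = K := by simpa using h
      rw [h1]
    · obtain ⟨K', hK', rfl⟩ := Option.map_eq_some_iff.1 h
      rw [ih hK', mul_assoc, mul_assoc, piece_comm h2]

/-- Distinct final pieces of a heap commute, and can be removed together. -/
theorem exists_common {u v : V} {H K : Heap G} (huv : u ≠ v)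
    (h : H * piece G u = K * piece G v) :
    ¬ G.Adj u v ∧ ∃ L, H = L * piece G v ∧ K = L * piece G u := by
  have h1 := pop_mul_self v K
  rw [← h, pop_mul_piece, if_neg huv] at h1
  split_ifs at h1 with h2
  obtain ⟨L, hL, rfl⟩ := Option.map_eq_some_iff.1 h1
  exact ⟨h2, L, pop_eq_some.1 hL, rfl⟩

end Heap

/-! ### Newton's identity for stable sets and pyramids -/

/-- No two vertices of `S` are adjacent. -/
def IsStable {V : Type*} (G : SimpleGraph V) (S : Finset V) : Prop :=
  ∀ u ∈ S, ∀ v ∈ S, ¬ G.Adj u v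

theorem IsStable.mono {V : Type*} {G : SimpleGraph V} {S T : Finset V} (h : IsStable G S)
    (hT : T ⊆ S) : IsStable G T :=
  fun u hu v hv => h u (hT hu) v (hT hv)

namespace Heap

variable {V : Type*} {G : SimpleGraph V}

theorem ofWord_eq_of_perm {a b : List V} (h : a.Perm b)
    (ha : ∀ u ∈ a, ∀ v ∈ a, ¬ G.Adj u v) : ofWord G a = ofWord G b := by
  induction h with
  | nil => rfl
  | cons x _ ih =>
    rw [ofWord_cons, ofWord_cons, ih fun u hu v hv => ha u (by simp [hu]) v (by simp [hv])]
  | swap x y l =>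
    simp only [ofWord_cons, ← mul_assoc]
    rw [piece_comm (ha y (by simp) x (by simp))]
  | trans h1 _ ih1 ih2 =>
    exact (ih1 ha).trans (ih2 fun u hu v hv => ha u (h1.mem_iff.2 hu) v (h1.mem_iff.2 hv))

/-- The heap whose pieces are the elements of `S`, each once. -/
noncomputable def ofSet (G : SimpleGraph V) (S : Finset V) : Heap G := ofWord G S.toList

theorem type_ofSet (S : Finset V) : (ofSet G S).type = S.val := by
  simp [ofSet, type_ofWord]

theorem ofSet_insert [DecidableEq V] {S : Finset V} {v : V} (hv : v ∉ S)
    (h : IsStable G (insert v S)) : ofSet G (insert v S) = piece G v * ofSet G S := by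
  rw [ofSet, ofSet, ← ofWord_cons]
  exact ofWord_eq_of_perm (Finset.toList_insert hv) (by simpa [IsStable] using h)

theorem piece_injective : Function.Injective (piece G) := fun u v h => by
  have := congrArg type h
  simpa [type_piece] using this

theorem mul_piece_ne_one (H : Heap G) (v : V) : H * piece G v ≠ 1 := fun h => by
  have := congrArg size h
  simp [size_mul, size_piece, size_one] at this

end Heap

open Heap

section Newton

variable {V : Type*} {G : SimpleGraph V}

/-- The vertex `v` can be moved between the pyramid `P` and the stable set `S`. -/
def Movable (x : Heap G × Finset V) (v : V) : Prop :=
  (v ∈ x.2 ∧ ∃ u ∈ x.1.type, Touch G u v) ∨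
    ∃ H, x.1 = H * piece G v ∧ H ≠ 1 ∧ ∀ s ∈ x.2, ¬ Touch G v s

/-- Moving `v` does not change the set of movable vertices. Hence a vertex chosen as a function of
that set is chosen again after the move, which is what makes the cancellation an involution. A
vertex of `S` does not touch `v`, so its contact with the pyramid is unaffected, and a final piece
other than `v` commutes past `v`. -/
theorem movable_iff [DecidableEq V] {P : Heap G} {S : Finset V} {v : V} (hv : v ∉ S)
    (hS : IsStable G (insert v S)) (hP : P.IsPyramid) (ht : ∃ u ∈ P.type, Touch G u v) (w : V) :
    Movable (P, insert v S) w ↔ Movable (P * piece G v, S) w := by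
  have hvS : ∀ s ∈ S, ¬ Touch G v s := by
    rintro s hs (rfl | h)
    · exact hv hs
    · exact hS v (by simp) s (by simp [hs]) h
  rcases eq_or_ne w v with rfl | hwv
  · exact iff_of_true (.inl ⟨by simp, ht⟩)
      (.inr ⟨P, rfl, fun h => not_isPyramid_one (h ▸ hP), hvS⟩)
  by_cases hw : w ∈ S
  · have h1 : ¬ ∃ H, P = H * piece G w ∧ H ≠ 1 ∧ ∀ s ∈ insert v S, ¬ Touch G w s := by
      rintro ⟨H, -, -, h⟩; exact h w (by simp [hw]) (.inl rfl)
    have h2 : ¬ ∃ H, P * piece G v = H * piece G w ∧ H ≠ 1 ∧ ∀ s ∈ S, ¬ Touch G w s := by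
      rintro ⟨H, -, -, h⟩; exact h w hw (.inl rfl)
    rw [Movable, or_iff_left h1]
    simp only [Movable, h2, or_false, hw, Finset.mem_insert, or_true, true_and, type_mul,
      type_piece, Multiset.mem_add, Multiset.mem_singleton, or_and_right, exists_or, exists_eq_left,
      hvS w hw]
  · simp only [Movable, Finset.mem_insert, hwv, hw, or_self, false_and, false_or,
      forall_eq_or_imp]
    constructor
    · rintro ⟨H, rfl, hH, hvw, h⟩
      refine ⟨H * piece G v, ?_, mul_piece_ne_one _ _, h⟩
      rw [mul_assoc, mul_assoc, piece_comm fun e => hvw (.inr e)]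
    · rintro ⟨H, hH, hH1, h⟩
      obtain ⟨hadj, L, rfl, rfl⟩ := exists_common hwv.symm hH
      have hvw : ¬ Touch G w v := by
        rintro (e | e)
        · exact hwv e
        · exact hadj e.symm
      refine ⟨L, rfl, ?_, hvw, h⟩
      -- Otherwise `w` is the only piece of the pyramid, so `v` touches it by `ht`, although the two
      -- commute and are distinct.
      rintro rfl
      obtain ⟨u, hu, huv⟩ := ht
      obtain rfl : u = w := by simpa [type_piece] using hu
      exact hvw huv

/-- Move `v` from the stable set to the pyramid or back. -/
noncomputable def toggle [DecidableEq V] (v : V) (x : Heap G × Finset V) : Heap G × Finset V :=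
  -- The default `1` plays no role for a movable vertex outside the stable set: it is a final piece
  -- of the pyramid, so the removal succeeds.
  if v ∈ x.2 then (x.1 * piece G v, x.2.erase v) else ((pop v x.1).getD 1, insert v x.2)

/-- Every movable vertex gives a move in one of the two directions. -/
theorem Movable.exists_move [DecidableEq V] {x : Heap G × Finset V} {v : V} (h : Movable x v)
    (hP : x.1.IsPyramid) (hS : IsStable G x.2) :
    ∃ (P : Heap G) (S : Finset V), v ∉ S ∧ IsStable G (insert v S) ∧ P.IsPyramid ∧
      (∃ u ∈ P.type, Touch G u v) ∧
      (x = (P, insert v S) ∧ toggle v x = (P * piece G v, S) ∨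
        x = (P * piece G v, S) ∧ toggle v x = (P, insert v S)) := by
  obtain ⟨P, S⟩ := x
  rcases h with ⟨hv, ht⟩ | ⟨H, rfl, hH, ht⟩
  · refine ⟨P, S.erase v, by simp, ?_, hP, ht, .inl ⟨?_, ?_⟩⟩
    · rwa [Finset.insert_erase hv]
    · rw [Finset.insert_erase hv]
    · have : v ∈ S := hv
      simp only [toggle, this, if_true]
  · have hv : v ∉ S := fun hv => ht v hv (.inl rfl)
    obtain ⟨h1, h2⟩ := (isPyramid_mul_piece hH).1 hP
    refine ⟨H, S, hv, ?_, h1, h2, .inr ⟨rfl, ?_⟩⟩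
    · intro a ha b hb hab
      rcases Finset.mem_insert.1 ha with rfl | ha'
      · rcases Finset.mem_insert.1 hb with rfl | hb'
        · exact G.loopless.irrefl _ hab
        · exact ht b hb' (.inr hab)
      · rcases Finset.mem_insert.1 hb with rfl | hb'
        · exact ht a ha' (.inr hab.symm)
        · exact hS a ha' b hb' hab
    · simp only [toggle, hv, if_false, pop_mul_self, Option.getD_some]

theorem toggle_insert [DecidableEq V] {P : Heap G} {S : Finset V} {v : V} (hv : v ∉ S) :
    toggle v (P, insert v S) = (P * piece G v, S) := by
  simp [toggle, hv]

theorem toggle_mul_piece [DecidableEq V] {P : Heap G} {S : Finset V} {v : V} (hv : v ∉ S) :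
    toggle v (P * piece G v, S) = (P, insert v S) := by
  simp [toggle, hv, pop_mul_self]

/-- A pair without movable vertices. -/
theorem not_movable_iff {P : Heap G} {S : Finset V} (hP : P.IsPyramid) :
    (¬ ∃ v, Movable (P, S) v) ↔ ∃ b, P = piece G b ∧ ∀ s ∈ S, ¬ Touch G b s := by
  constructor
  · intro h
    have hS : ∀ s ∈ S, ∀ u ∈ P.type, ¬ Touch G u s := fun s hs u hu hus =>
      h ⟨s, .inl ⟨hs, u, hu, hus⟩⟩
    obtain rfl | ⟨H, b, rfl⟩ := P.eq_one_or_eq_mul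
    · exact absurd hP not_isPyramid_one
    have hb : ∀ s ∈ S, ¬ Touch G b s := fun s hs => hS s hs b (by simp [type_mul, type_piece])
    have hH : H = 1 := by
      by_contra hH
      exact h ⟨b, .inr ⟨H, rfl, hH, hb⟩⟩
    exact ⟨b, by rw [hH, one_mul], hb⟩
  · rintro ⟨b, rfl, hb⟩ ⟨v, ⟨hv, u, hu, huv⟩ | ⟨H, hH, hH1, -⟩⟩
    · obtain rfl : u = b := by simpa [type_piece] using hu
      exact hb v hv huv
    · refine hH1 (eq_one_of_size H ?_)
      have := congrArg size hH
      simpa [size_mul, size_piece] using this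

variable {R : Type*} [Ring R] (φ : Heap G →* R)

/-- The signed contribution of a pyramid and a stable set. -/
noncomputable def newtonTerm (x : Heap G × Finset V) : R :=
  (-1) ^ (x.1.size + 1) * (φ x.1 * φ (ofSet G x.2))

/-- The composite of pyramid and stable set stays the same heap, by associativity, while the size of
the pyramid changes by one and flips the sign. -/
theorem newtonTerm_move [DecidableEq V] {P : Heap G} {S : Finset V} {v : V} (hv : v ∉ S)
    (hS : IsStable G (insert v S)) :
    newtonTerm φ (P, insert v S) + newtonTerm φ (P * piece G v, S) = 0 := by
  simp only [newtonTerm, ofSet_insert hv hS, size_mul, size_piece, map_mul, pow_succ, mul_assoc]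
  simp

variable [Fintype V]

variable (G) in
open Classical in
/-- The stable sets with `n` elements. -/
noncomputable def stableSets (n : ℕ) : Finset (Finset V) :=
  Finset.univ.filter fun S => IsStable G S ∧ S.card = n

theorem mem_stableSets {n : ℕ} {S : Finset V} :
    S ∈ stableSets G n ↔ IsStable G S ∧ S.card = n := by
  simp [stableSets]

variable (G) in
open Classical in
/-- The pyramids with `n` pieces. -/
noncomputable def pyramids (n : ℕ) : Finset (Heap G) :=
  (finite_size_le n).toFinset.filter fun H => H.IsPyramid ∧ H.size = n

theorem mem_pyramids {n : ℕ} {H : Heap G} : H ∈ pyramids G n ↔ H.IsPyramid ∧ H.size = n := by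
  simp only [pyramids, Finset.mem_filter, Set.Finite.mem_toFinset, Set.mem_ofPred_eq]
  exact ⟨fun h => h.2, fun h => ⟨h.2.le, h⟩⟩

variable (G) in
open Classical in
/-- Pairs of a pyramid and a stable set with `n` pieces in total. -/
noncomputable def newtonPairs (n : ℕ) : Finset (Heap G × Finset V) :=
  ((finite_size_le n).toFinset ×ˢ Finset.univ).filter fun x =>
    x.1.IsPyramid ∧ IsStable G x.2 ∧ x.1.size + x.2.card = n

theorem mem_newtonPairs {n : ℕ} {x : Heap G × Finset V} :
    x ∈ newtonPairs G n ↔ x.1.IsPyramid ∧ IsStable G x.2 ∧ x.1.size + x.2.card = n := by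
  simp only [newtonPairs, Finset.mem_filter, Finset.mem_product, Set.Finite.mem_toFinset,
    Set.mem_ofPred_eq, Finset.mem_univ, and_true]
  exact ⟨fun h => h.2, fun h => ⟨by have := h.2.2; omega, h⟩⟩

/-- The sum of the stable sets with `n` elements. -/
noncomputable def stableSum (n : ℕ) : R := ∑ S ∈ stableSets G n, φ (ofSet G S)

/-- The sum of the pyramids with `n` pieces. -/
noncomputable def pyramidSum (n : ℕ) : R := ∑ P ∈ pyramids G n, φ P

open Classical in
theorem sum_movable (n : ℕ) :
    ∑ x ∈ (newtonPairs G n).filter (fun x => ∃ v, Movable x v), newtonTerm φ x = 0 := by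
  have hmv : ∀ x (v : V), Movable x v → x ∈ newtonPairs G n →
      newtonTerm φ x + newtonTerm φ (toggle v x) = 0 ∧ toggle v x ∈ newtonPairs G n ∧
        toggle v x ≠ x ∧ toggle v (toggle v x) = x ∧ Movable (toggle v x) = Movable x := by
    intro x v hv hx
    obtain ⟨hxP, hxS, hn⟩ := mem_newtonPairs.1 hx
    obtain ⟨P, S, hvS, hS, hP, ht, ⟨rfl, h⟩ | ⟨rfl, h⟩⟩ := hv.exists_move hxP hxS
    · rw [h]
      have hP1 : P ≠ 1 := fun e => not_isPyramid_one (e ▸ hP)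
      refine ⟨newtonTerm_move φ hvS hS, mem_newtonPairs.2 ⟨(isPyramid_mul_piece hP1).2 ⟨hP, ht⟩,
        hS.mono (Finset.subset_insert _ _), ?_⟩, ?_, toggle_mul_piece hvS, ?_⟩
      · simp only [Finset.card_insert_of_notMem hvS] at hn
        simp only [size_mul, size_piece]; omega
      · intro e
        have e' : S = insert v S := congrArg Prod.snd e
        exact hvS (e' ▸ Finset.mem_insert_self v S)
      · exact funext fun w => propext (movable_iff hvS hS hP ht w).symm
    · rw [h]
      refine ⟨by rw [add_comm]; exact newtonTerm_move φ hvS hS, mem_newtonPairs.2 ⟨hP, hS, ?_⟩, ?_,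
        toggle_insert hvS, ?_⟩
      · simp only [size_mul, size_piece] at hn
        simp only [Finset.card_insert_of_notMem hvS]; omega
      · intro e
        have e' : insert v S = S := congrArg Prod.snd e
        exact hvS (e' ▸ Finset.mem_insert_self v S)
      · exact funext fun w => propext (movable_iff hvS hS hP ht w)
  -- The choice takes only the predicate as input, so pairs with the same movable vertices get the
  -- same vertex.
  let pick : (V → Prop) → Option V := fun p => if h : ∃ v, p v then some h.choose else none
  let g : Heap G × Finset V → Heap G × Finset V := fun x =>
    ((pick (Movable x)).map fun v => toggle v x).getD x
  have hg : ∀ x, (∃ v, Movable x v) → ∃ v, Movable x v ∧ g x = toggle v x ∧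
      ∀ y, Movable y = Movable x → g y = toggle v y := by
    intro x hx
    refine ⟨hx.choose, hx.choose_spec, by simp only [g, pick, dif_pos hx]; rfl, fun y hy => ?_⟩
    simp only [g, hy, pick, dif_pos hx]; rfl
  refine Finset.sum_involution (fun x _ => g x) ?_ ?_ ?_ ?_
  · intro x hx
    obtain ⟨hx, hm⟩ := Finset.mem_filter.1 hx
    obtain ⟨v, hv, h, -⟩ := hg x hm
    rw [h]; exact (hmv x v hv hx).1
  · intro x hx _
    obtain ⟨hx, hm⟩ := Finset.mem_filter.1 hx
    obtain ⟨v, hv, h, -⟩ := hg x hm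
    rw [h]; exact (hmv x v hv hx).2.2.1
  · intro x hx
    obtain ⟨hx, hm⟩ := Finset.mem_filter.1 hx
    obtain ⟨v, hv, h, -⟩ := hg x hm
    rw [h]
    refine Finset.mem_filter.2 ⟨(hmv x v hv hx).2.1, v, ?_⟩
    rw [(hmv x v hv hx).2.2.2.2]; exact hv
  · intro x hx
    obtain ⟨hx, hm⟩ := Finset.mem_filter.1 hx
    obtain ⟨v, hv, h, h'⟩ := hg x hm
    rw [h, h' _ (hmv x v hv hx).2.2.2.2]; exact (hmv x v hv hx).2.2.2.1

open Classical in
-- The surviving pairs are a single piece `b` with the rest of a stable set of size `n` containing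
-- `b`. Each stable set arises once for every one of its `n` elements, with positive sign.
theorem sum_not_movable (n : ℕ) :
    ∑ x ∈ (newtonPairs G n).filter (fun x => ¬ ∃ v, Movable x v), newtonTerm φ x =
      (n : R) * stableSum φ n := by
  have h1 : (n : R) * stableSum φ n =
      ∑ y ∈ (stableSets G n).sigma fun S => S, φ (ofSet G y.1) := by
    rw [Finset.sum_sigma, stableSum, Finset.mul_sum]
    refine Finset.sum_congr rfl fun S hS => ?_
    simp [(mem_stableSets.1 hS).2]
  rw [h1]
  symm
  refine Finset.sum_bij (fun y _ => (piece G y.2, y.1.erase y.2)) ?_ ?_ ?_ ?_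
  · rintro ⟨S, b⟩ hy
    obtain ⟨hS, hb⟩ : S ∈ stableSets G n ∧ b ∈ S := by simpa using hy
    obtain ⟨hS, hn⟩ := mem_stableSets.1 hS
    refine Finset.mem_filter.2 ⟨mem_newtonPairs.2 ⟨isPyramid_piece b,
      hS.mono (Finset.erase_subset _ _), ?_⟩, (not_movable_iff (isPyramid_piece b)).2
      ⟨b, rfl, ?_⟩⟩
    · have := Finset.card_erase_add_one hb
      simp only [size_piece]; omega
    · rintro s hs (rfl | h)
      · simp at hs
      · exact hS b hb s (Finset.mem_of_mem_erase hs) h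
  · rintro ⟨S, b⟩ hy ⟨S', b'⟩ hy' h
    obtain ⟨hS, hb⟩ : S ∈ stableSets G n ∧ b ∈ S := by simpa using hy
    obtain ⟨hS', hb'⟩ : S' ∈ stableSets G n ∧ b' ∈ S' := by simpa using hy'
    simp only [Prod.mk.injEq] at h
    obtain rfl := piece_injective h.1
    obtain rfl : S = S' := by rw [← Finset.insert_erase hb, h.2, Finset.insert_erase hb']
    rfl
  · rintro ⟨P, S⟩ hx
    obtain ⟨hx, hm⟩ := Finset.mem_filter.1 hx
    obtain ⟨hP, hS, hn⟩ := mem_newtonPairs.1 hx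
    obtain ⟨b, rfl, hb⟩ := (not_movable_iff hP).1 hm
    have hbS : b ∉ S := fun h => hb b h (.inl rfl)
    refine ⟨⟨insert b S, b⟩, ?_, ?_⟩
    · simp only [Finset.mem_sigma, Finset.mem_insert_self, and_true]
      refine mem_stableSets.2 ⟨?_, ?_⟩
      · intro u hu w hw huw
        rcases Finset.mem_insert.1 hu with rfl | hu'
        · rcases Finset.mem_insert.1 hw with rfl | hw'
          · exact G.loopless.irrefl _ huw
          · exact hb w hw' (.inr huw)
        · rcases Finset.mem_insert.1 hw with rfl | hw'
          · exact hb u hu' (.inr huw.symm)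
          · exact hS u hu' w hw' huw
      · rw [Finset.card_insert_of_notMem hbS]
        simp only [size_piece] at hn; omega
    · simp [hbS]
  · rintro ⟨S, b⟩ hy
    obtain ⟨hS, hb⟩ : S ∈ stableSets G n ∧ b ∈ S := by simpa using hy
    have h : ofSet G S = piece G b * ofSet G (S.erase b) := by
      rw [← ofSet_insert (Finset.notMem_erase b S), Finset.insert_erase hb]
      rw [Finset.insert_erase hb]; exact (mem_stableSets.1 hS).1
    simp [newtonTerm, size_piece, h]

/-- Newton's identity. -/
theorem natCast_mul_stableSum (n : ℕ) :
    (n : R) * stableSum φ n = ∑ a ∈ Finset.HasAntidiagonal.antidiagonal n,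
      (-1) ^ (a.1 + 1) * (pyramidSum φ a.1 * stableSum φ a.2) := by
  classical
  have h := Finset.sum_filter_add_sum_filter_not (newtonPairs G n) (fun x => ∃ v, Movable x v)
    (newtonTerm φ)
  rw [sum_movable, sum_not_movable, zero_add] at h
  rw [h, ← Finset.sum_fiberwise_of_maps_to
    (g := fun x : Heap G × Finset V => (x.1.size, x.2.card))
    (t := Finset.HasAntidiagonal.antidiagonal n)
    (fun x hx => by simpa using (mem_newtonPairs.1 hx).2.2)]
  refine Finset.sum_congr rfl fun a ha => ?_
  rw [pyramidSum, stableSum, Finset.sum_mul_sum, ← Finset.sum_product', Finset.mul_sum]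
  refine Finset.sum_congr ?_ ?_
  · ext ⟨P, S⟩
    have := Finset.HasAntidiagonal.mem_antidiagonal.1 ha
    simp only [Finset.mem_filter, mem_newtonPairs, Finset.mem_product, mem_pyramids,
      mem_stableSets, Prod.ext_iff]
    constructor
    · rintro ⟨⟨h1, h2, -⟩, h3, h4⟩; exact ⟨⟨h1, h3⟩, h2, h4⟩
    · rintro ⟨⟨h1, h3⟩, h2, h4⟩; exact ⟨⟨h1, h2, by omega⟩, h3, h4⟩
  · rintro ⟨P, S⟩ hx
    have := (mem_pyramids.1 (Finset.mem_product.1 hx).1).2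
    simp only at this
    simp only [newtonTerm, this]

theorem stableSum_zero : stableSum φ 0 = 1 := by
  have : stableSets G 0 = {∅} := by
    ext S
    simp only [mem_stableSets, Finset.card_eq_zero, Finset.mem_singleton, and_iff_right_iff_imp]
    rintro rfl
    simp [IsStable]
  rw [stableSum, this, Finset.sum_singleton]
  simp [ofSet, ofWord_nil]

theorem pyramidSum_zero : pyramidSum φ 0 = 0 := by
  refine Finset.sum_eq_zero fun P hP => ?_
  obtain ⟨h1, h2⟩ := mem_pyramids.1 hP
  exact absurd (eq_one_of_size P h2 ▸ h1) not_isPyramid_one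

end Newton

/-! ### The sums of stable sets commute up to ascents -/

section Cross

variable {V : Type*} [LinearOrder V] (G : SimpleGraph V)

open Classical in
/-- The number of edges from `S` up to `T`. -/
noncomputable def cross (S T : Finset V) : ℕ :=
  ((S ×ˢ T).filter fun p => G.Adj p.1 p.2 ∧ p.1 < p.2).card

/-- Of two nonadjacent neighbours of a vertex one is smaller and the other one is larger. -/
def SeparatesNeighbours : Prop :=
  ∀ u v w, G.Adj u v → G.Adj u w → v ≠ w → ¬ G.Adj v w → (v < u ∧ u < w) ∨ (w < u ∧ u < v)

/-- Distinct nonadjacent vertices are comparable in the poset, and a common neighbour is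
incomparable to both, so the labelling puts it between them. This is all that the rest of the proof
needs from the order. -/
theorem separatesNeighbours_of_isNaturalLabelling (r : V → V → Prop) [IsPartialOrder V r]
    (h : IsNaturalLabelling r) : SeparatesNeighbours (incompGraph r) := by
  intro u v w huv huw hvw hn
  have hn' : r v w ∨ r w v := by
    by_contra hc
    push Not at hc
    exact hn ⟨hc.1, hc.2⟩
  rcases hn' with hr | hr
  · exact .inl (h.2 v u w ⟨hr, hvw⟩ ⟨huv.2, huv.1⟩ huw)
  · exact .inr (h.2 w u v ⟨hr, hvw.symm⟩ ⟨huw.2, huw.1⟩ huv)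

variable {G}

/-- Two larger neighbours of one vertex in a stable set would be nonadjacent neighbours on the same
side of it. So an ascending edge is determined by its lower end. -/
theorem cross_le_left (hG : SeparatesNeighbours G) {S T : Finset V} (hT : IsStable G T) :
    cross G S T ≤ S.card := by
  classical
  refine Finset.card_le_card_of_injOn Prod.fst (fun p hp => ?_) ?_
  · exact (Finset.mem_product.1 (Finset.mem_filter.1 hp).1).1
  · rintro ⟨u, v⟩ hp ⟨u', v'⟩ hp' (rfl : u = u')
    simp only [Finset.coe_filter, Finset.mem_product, Set.mem_ofPred_eq] at hp hp'
    obtain ⟨⟨-, hv⟩, ha, hl⟩ := hp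
    obtain ⟨⟨-, hv'⟩, ha', hl'⟩ := hp'
    by_contra hne
    have hne' : v ≠ v' := fun e => hne (by rw [e])
    rcases hG u v v' ha ha' hne' (hT v hv v' hv') with h | h
    · exact lt_asymm h.1 hl
    · exact lt_asymm h.1 hl'

theorem cross_le_right (hG : SeparatesNeighbours G) {S T : Finset V} (hS : IsStable G S) :
    cross G S T ≤ T.card := by
  classical
  refine Finset.card_le_card_of_injOn Prod.snd (fun p hp => ?_) ?_
  · exact (Finset.mem_product.1 (Finset.mem_filter.1 hp).1).2
  · rintro ⟨u, v⟩ hp ⟨u', v'⟩ hp' (rfl : v = v')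
    simp only [Finset.coe_filter, Finset.mem_product, Set.mem_ofPred_eq] at hp hp'
    obtain ⟨⟨hu, -⟩, ha, hl⟩ := hp
    obtain ⟨⟨hu', -⟩, ha', hl'⟩ := hp'
    by_contra hne
    have hne' : u ≠ u' := fun e => hne (by rw [e])
    rcases hG v u u' ha.symm ha'.symm hne' (hS u hu u' hu') with h | h
    · exact lt_asymm h.2 hl'
    · exact lt_asymm h.2 hl

variable (G) in
/-- The graph on `V` with the edges of `G` inside `U`. -/
def within (U : Finset V) : SimpleGraph V where
  Adj u v := G.Adj u v ∧ u ∈ U ∧ v ∈ U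
  symm := ⟨fun _ _ h => ⟨h.1.symm, h.2.2, h.2.1⟩⟩
  loopless := ⟨fun _ h => G.loopless.irrefl _ h.1⟩

theorem eq_of_isolated {V : Type*} {K : SimpleGraph V} {x w : V} (hx : ∀ y, ¬ K.Adj x y)
    (h : K.connectedComponentMk w = K.connectedComponentMk x) : w = x := by
  obtain ⟨p⟩ := (SimpleGraph.ConnectedComponent.eq.1 h).symm
  cases p with
  | nil => rfl
  | cons h _ => exact absurd h (hx _)

open Classical in
/-- A connected graph has many edges. -/
theorem card_add_card_le [Finite V] {U : Finset V} (c : (within G U).ConnectedComponent)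
    {A B : Finset V} (hAB : ∀ v, v ∈ A ∨ v ∈ B ↔ (within G U).connectedComponentMk v = c)
    (hd : Disjoint A B) (hA : IsStable G A) (hB : IsStable G B) :
    A.card + B.card ≤ cross G A B + cross G B A + 1 := by
  -- Oriented towards its larger end, every edge of the component runs from `A` to `B` or from `B`
  -- to `A`, by stability. Connectedness then bounds the number of these pairs from below.
  let P : Finset (V × V) := ((A ×ˢ B).filter fun p => G.Adj p.1 p.2 ∧ p.1 < p.2) ∪
    ((B ×ˢ A).filter fun p => G.Adj p.1 p.2 ∧ p.1 < p.2)
  have h1 : Nat.card c.supp = A.card + B.card := by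
    rw [← Finset.card_union_of_disjoint hd, Nat.card_coe_set_eq, ← Set.ncard_coe_finset]
    congr 1
    ext v
    rw [SimpleGraph.ConnectedComponent.mem_supp_iff, ← hAB]
    simp
  have h2 := c.connected_toSimpleGraph.card_vert_le_card_edgeSet_add_one
  have h3 : Nat.card c.toSimpleGraph.edgeSet ≤ P.card := by
    rw [Nat.card_coe_set_eq, ← Set.ncard_image_of_injective _
      (Sym2.map.injective (Subtype.val_injective (p := (· ∈ c.supp))))]
    refine (Set.ncard_le_ncard (t := ((P.image fun p => s(p.1, p.2) : Finset (Sym2 V)) :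
      Set (Sym2 V))) ?_ (Finset.finite_toSet _)).trans ?_
    · rintro _ ⟨e, he, rfl⟩
      induction e with | _ x y
      obtain ⟨x, hx⟩ := x
      obtain ⟨y, hy⟩ := y
      have hxy : G.Adj x y := by
        have : (within G U).Adj x y := he
        exact this.1
      rw [SimpleGraph.ConnectedComponent.mem_supp_iff, ← hAB] at hx hy
      have key : ∀ x y, G.Adj x y → (x ∈ A ∨ x ∈ B) → (y ∈ A ∨ y ∈ B) → x < y → (x, y) ∈ P := by
        intro x y hxy hx hy hlt
        simp only [P, Finset.mem_union, Finset.mem_filter, Finset.mem_product, hxy, hlt,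
          and_self, and_true]
        rcases hx with hx | hx <;> rcases hy with hy | hy
        · exact absurd hxy (hA x hx y hy)
        · exact .inl ⟨hx, hy⟩
        · exact .inr ⟨hx, hy⟩
        · exact absurd hxy (hB x hx y hy)
      simp only [Sym2.map_mk, Finset.coe_image, Set.mem_image, Finset.mem_coe]
      rcases lt_or_gt_of_ne hxy.ne with hlt | hlt
      · exact ⟨(x, y), key x y hxy hx hy hlt, rfl⟩
      · exact ⟨(y, x), key y x hxy.symm hy hx hlt, Sym2.eq_swap⟩
    · rw [Set.ncard_coe_finset]
      exact Finset.card_image_le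
  have h4 : P.card ≤ cross G A B + cross G B A := Finset.card_union_le _ _
  change Nat.card c.supp ≤ _ at h2
  omega

/-! ### Exchanging two stable sets on their unbalanced components -/

section Swap

variable [Fintype V] (U S T : Finset V)

open Classical in
/-- The part of `S` in the component `c`. -/
noncomputable def inComp (c : (within G U).ConnectedComponent) (S : Finset V) : Finset V :=
  S.filter fun v => (within G U).connectedComponentMk v = c

variable (G) in
open Classical in
/-- The vertices of the components in which `S` and `T` have different sizes are moved from `S`
to `T` and back. -/
noncomputable def swapUnbalanced : Finset V := Finset.univ.filter fun v =>
  if (inComp U ((within G U).connectedComponentMk v) S).card =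
    (inComp U ((within G U).connectedComponentMk v) T).card then v ∈ S else v ∈ T

variable {U S T}

theorem mem_inComp {V : Type*} {G : SimpleGraph V} {U S : Finset V}
    {c : (within G U).ConnectedComponent} {v : V} :
    v ∈ inComp U c S ↔ v ∈ S ∧ (within G U).connectedComponentMk v = c := by
  simp only [inComp, Finset.mem_filter]

theorem mem_swapUnbalanced_iff {v : V} : v ∈ swapUnbalanced G U S T ↔
    if (inComp U ((within G U).connectedComponentMk v) S).card =
      (inComp U ((within G U).connectedComponentMk v) T).card then v ∈ S else v ∈ T := by
  simp only [swapUnbalanced, Finset.mem_filter, Finset.mem_univ, true_and]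

theorem inComp_swapUnbalanced (c : (within G U).ConnectedComponent) :
    inComp U c (swapUnbalanced G U S T) =
      if (inComp U c S).card = (inComp U c T).card then inComp U c S else inComp U c T := by
  classical
  ext v
  by_cases hv : (within G U).connectedComponentMk v = c
  · subst hv
    rw [mem_inComp, mem_swapUnbalanced_iff]
    split_ifs with h <;> simp [mem_inComp]
  · split_ifs <;> simp [inComp, hv]

/-- Each direction has at most as many ascents as the smaller of the two parts has vertices, while
connectedness requires at least the number of all vertices minus one in total. When the sizes
differ, both directions must attain the bound. -/
theorem cross_inComp_comm (hG : SeparatesNeighbours G) (hU : ∀ v, v ∈ U ↔ v ∈ S ∨ v ∈ T)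
    (hS : IsStable G S) (hT : IsStable G T) (c : (within G U).ConnectedComponent)
    (hc : (inComp U c S).card ≠ (inComp U c T).card) :
    cross G (inComp U c S) (inComp U c T) = cross G (inComp U c T) (inComp U c S) := by
  classical
  have hA : IsStable G (inComp U c S) := hS.mono (Finset.filter_subset _ _)
  have hB : IsStable G (inComp U c T) := hT.mono (Finset.filter_subset _ _)
  -- A common vertex of two stable sets has no neighbour in their union; its component would be a
  -- balanced singleton, contrary to `hc`.
  have hd : Disjoint (inComp U c S) (inComp U c T) := by
    rw [Finset.disjoint_left]
    intro x hx hx'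
    obtain ⟨hxS, rfl⟩ := Finset.mem_filter.1 hx
    obtain ⟨hxT, -⟩ := Finset.mem_filter.1 hx'
    refine hc ?_
    have hiso : ∀ y, ¬ (within G U).Adj x y := by
      rintro y ⟨h, -, hy⟩
      rcases (hU y).1 hy with hy | hy
      · exact hS x hxS y hy h
      · exact hT x hxT y hy h
    have : ∀ X : Finset V, x ∈ X →
        inComp U ((within G U).connectedComponentMk x) X = {x} := fun X hX => by
      ext w
      simp only [inComp, Finset.mem_filter, Finset.mem_singleton]
      exact ⟨fun h => eq_of_isolated hiso h.2, by rintro rfl; exact ⟨hX, rfl⟩⟩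
    rw [this S hxS, this T hxT]
  have hcov : ∀ v, v ∈ inComp U c S ∨ v ∈ inComp U c T ↔
      (within G U).connectedComponentMk v = c := by
    intro v
    simp only [inComp, Finset.mem_filter]
    refine ⟨fun h => h.elim And.right And.right, fun h => ?_⟩
    by_cases hv : v ∈ U
    · exact ((hU v).1 hv).imp (⟨·, h⟩) (⟨·, h⟩)
    -- A vertex outside `U` is isolated, and both parts of its component are empty, hence of equal
    -- size.
    · refine absurd ?_ hc
      have : ∀ X : Finset V, (∀ x ∈ X, x ∈ U) → inComp U c X = ∅ := fun X hX => by
        refine Finset.filter_eq_empty_iff.2 fun x hx hxc => hv ?_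
        rw [← eq_of_isolated (K := within G U) (x := v) (fun y hy => hv hy.2.1) (hxc.trans h.symm)]
        exact hX x hx
      rw [this S fun x hx => (hU x).2 (.inl hx), this T fun x hx => (hU x).2 (.inr hx)]
  have h0 := card_add_card_le c hcov hd hA hB
  have h1 := cross_le_left hG (S := inComp U c S) hB
  have h2 := cross_le_right hG (T := inComp U c T) hA
  have h3 := cross_le_left hG (S := inComp U c T) hA
  have h4 := cross_le_right hG (T := inComp U c S) hB
  omega

open Classical in
theorem cross_eq_sum {X Y : Finset V} (hX : X ⊆ U) (hY : Y ⊆ U) :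
    cross G X Y = ∑ c : (within G U).ConnectedComponent,
      cross G (inComp U c X) (inComp U c Y) := by
  rw [cross, Finset.card_eq_sum_card_fiberwise
    (f := fun p : V × V => (within G U).connectedComponentMk p.1) (t := Finset.univ)
    (fun _ _ => Finset.mem_univ _)]
  refine Finset.sum_congr rfl fun c _ => congrArg Finset.card ?_
  ext ⟨u, v⟩
  simp only [inComp, Finset.mem_filter, Finset.mem_product]
  constructor
  · rintro ⟨⟨⟨hu, hv⟩, ha, hl⟩, hc⟩
    refine ⟨⟨⟨hu, hc⟩, hv, ?_⟩, ha, hl⟩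
    rw [← hc]
    exact SimpleGraph.ConnectedComponent.sound
      (SimpleGraph.Adj.reachable (G := within G U) ⟨ha.symm, hY hv, hX hu⟩)
  · rintro ⟨⟨⟨hu, hc⟩, hv, -⟩, ha, hl⟩
    exact ⟨⟨⟨hu, hv⟩, ha, hl⟩, hc⟩

open Classical in
theorem card_eq_sum_inComp (X : Finset V) :
    X.card = ∑ c : (within G U).ConnectedComponent, (inComp U c X).card :=
  Finset.card_eq_sum_card_fiberwise (fun _ _ => Finset.mem_univ _)

theorem mem_swapUnbalanced (v : V) :
    (v ∈ swapUnbalanced G U S T ↔ v ∈ S) ∧ (v ∈ swapUnbalanced G U T S ↔ v ∈ T) ∨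
      (v ∈ swapUnbalanced G U S T ↔ v ∈ T) ∧ (v ∈ swapUnbalanced G U T S ↔ v ∈ S) := by
  classical
  by_cases h : (inComp U ((within G U).connectedComponentMk v) S).card =
    (inComp U ((within G U).connectedComponentMk v) T).card
  · exact .inl (by simp [swapUnbalanced, h])
  · exact .inr (by simp [swapUnbalanced, h, Ne.symm h])

/-- Where nothing is exchanged the two parts have the same size anyway, so every component
contributes the size of its part of `T`. -/
theorem card_swapUnbalanced : (swapUnbalanced G U S T).card = T.card := by
  classical
  rw [card_eq_sum_inComp (G := G) (U := U), card_eq_sum_inComp (G := G) (U := U) T]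
  refine Finset.sum_congr rfl fun c _ => ?_
  rw [inComp_swapUnbalanced]
  split_ifs with h
  · exact h
  · rfl

theorem isStable_swapUnbalanced (hU : ∀ v, v ∈ U ↔ v ∈ S ∨ v ∈ T)
    (hS : IsStable G S) (hT : IsStable G T) : IsStable G (swapUnbalanced G U S T) := by
  classical
  have hsub : ∀ u ∈ swapUnbalanced G U S T, u ∈ U := fun u hu => by
    rw [hU]
    rcases mem_swapUnbalanced (G := G) (U := U) (S := S) (T := T) u with h | h
    · exact .inl (h.1.1 hu)
    · exact .inr (h.1.1 hu)
  intro u hu v hv huv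
  have hc : (within G U).connectedComponentMk u = (within G U).connectedComponentMk v :=
    SimpleGraph.ConnectedComponent.sound
      (SimpleGraph.Adj.reachable (G := within G U) ⟨huv, hsub u hu, hsub v hv⟩)
  have hu' : u ∈ inComp U ((within G U).connectedComponentMk v) (swapUnbalanced G U S T) :=
    Finset.mem_filter.2 ⟨hu, hc⟩
  have hv' : v ∈ inComp U ((within G U).connectedComponentMk v) (swapUnbalanced G U S T) :=
    Finset.mem_filter.2 ⟨hv, rfl⟩
  rw [inComp_swapUnbalanced] at hu' hv'
  split_ifs at hu' hv'
  · exact hS u (Finset.mem_filter.1 hu').1 v (Finset.mem_filter.1 hv').1 huv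
  · exact hT u (Finset.mem_filter.1 hu').1 v (Finset.mem_filter.1 hv').1 huv

theorem cross_swapUnbalanced (hG : SeparatesNeighbours G) (hU : ∀ v, v ∈ U ↔ v ∈ S ∨ v ∈ T)
    (hS : IsStable G S) (hT : IsStable G T) :
    cross G (swapUnbalanced G U S T) (swapUnbalanced G U T S) = cross G S T := by
  classical
  have hsub : ∀ {S T : Finset V}, (∀ v, v ∈ U ↔ v ∈ S ∨ v ∈ T) → swapUnbalanced G U S T ⊆ U :=
    fun {S T} hU u hu => by
      rw [hU]
      rcases mem_swapUnbalanced (G := G) (U := U) (S := S) (T := T) u with h | h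
      · exact .inl (h.1.1 hu)
      · exact .inr (h.1.1 hu)
  have hU' : ∀ v, v ∈ U ↔ v ∈ T ∨ v ∈ S := fun v => (hU v).trans or_comm
  rw [cross_eq_sum (hsub hU) (hsub hU'),
    cross_eq_sum (U := U) (fun v hv => (hU v).2 (.inl hv)) (fun v hv => (hU v).2 (.inr hv))]
  refine Finset.sum_congr rfl fun c _ => ?_
  rw [inComp_swapUnbalanced, inComp_swapUnbalanced]
  by_cases h : (inComp U c S).card = (inComp U c T).card
  · rw [if_pos h, if_pos h.symm]
  · rw [if_neg h, if_neg (Ne.symm h)]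
    exact (cross_inComp_comm hG hU hS hT c h).symm

/-- The exchange preserves which components are unbalanced, so doing it twice restores both sets. -/
theorem swapUnbalanced_swapUnbalanced :
    swapUnbalanced G U (swapUnbalanced G U S T) (swapUnbalanced G U T S) = S := by
  ext v
  simp only [mem_swapUnbalanced_iff, inComp_swapUnbalanced]
  by_cases h : (inComp U ((within G U).connectedComponentMk v) S).card =
    (inComp U ((within G U).connectedComponentMk v) T).card
  · simp [h]
  · simp [h, Ne.symm h]

theorem union_swapUnbalanced :
    (∀ v, v ∈ U ↔ v ∈ swapUnbalanced G U S T ∨ v ∈ swapUnbalanced G U T S) ↔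
      ∀ v, v ∈ U ↔ v ∈ S ∨ v ∈ T := by
  refine forall_congr' fun v => ?_
  rcases mem_swapUnbalanced (G := G) (U := U) (S := S) (T := T) v with h | h
  · rw [h.1, h.2]
  · rw [h.1, h.2, or_comm (a := v ∈ T)]

theorem val_add_val_swapUnbalanced :
    (swapUnbalanced G U S T).val + (swapUnbalanced G U T S).val = S.val + T.val := by
  classical
  ext v
  have key : ∀ X : Finset V, X.val.count v = if v ∈ X then 1 else 0 := fun X =>
    Multiset.count_eq_of_nodup X.nodup
  simp only [Multiset.count_add, key]
  rcases mem_swapUnbalanced (G := G) (U := U) (S := S) (T := T) v with h | h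
  · simp only [h.1, h.2]
  · simp only [h.1, h.2, add_comm]

end Swap

/-! ### Words up to letters and ascents -/

variable (G) in
/-- Words in `V` up to rearrangements that keep the number of ascents. -/
abbrev AscMonoid : Type _ := (ascCon G).Quotient

theorem conGen_le_ascCon : conGen (CommRel G) ≤ ascCon G := by
  refine Con.conGen_le.2 ?_
  rintro _ _ ⟨u, v, h⟩
  have h' : ¬ G.Adj v u := fun e => h e.symm
  exact ⟨by simpa using List.Perm.swap v u [], by simp [wordAsc, h, h']⟩

variable (G) in
/-- The class of a heap under its type and its number of ascents. -/
def toAsc : Heap G →* AscMonoid G := Con.map _ _ conGen_le_ascCon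

theorem toAsc_ofWord (w : List V) :
    toAsc G (Heap.ofWord G w) = ((FreeMonoid.ofList w : FreeMonoid V) : AscMonoid G) := rfl

variable (G) in
/-- The class of a heap in the monoid algebra. -/
noncomputable def ascHom : Heap G →* MonoidAlgebra ℚ (AscMonoid G) :=
  (MonoidAlgebra.of ℚ (AscMonoid G)).comp (toAsc G)

theorem Heap.asc_ofWord (w : List V) : (Heap.ofWord G w).asc = wordAsc G w := rfl

theorem wordAsc_eq_zero {w : List V} (h : ∀ u ∈ w, ∀ v ∈ w, ¬ G.Adj u v) : wordAsc G w = 0 := by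
  classical
  induction w with
  | nil => rfl
  | cons u w ih =>
    rw [wordAsc, ih fun a ha b hb => h a (by simp [ha]) b (by simp [hb]), add_zero,
      List.countP_eq_zero]
    intro v hv
    simp [h u (by simp) v (by simp [hv])]

open Classical in
theorem sum_map_countP (S T : Finset V) :
    (S.toList.map fun u => T.toList.countP fun v => G.Adj u v ∧ u < v).sum = cross G S T := by
  have h1 : ∀ u, (T.toList.countP fun v => G.Adj u v ∧ u < v) =
      (T.filter fun v => G.Adj u v ∧ u < v).card := fun u => by
    rw [← Multiset.coe_countP, Finset.coe_toList, Multiset.countP_eq_card_filter]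
    simp [Finset.card_def]
  simp only [h1]
  rw [Finset.sum_map_toList, cross, Finset.card_filter, Finset.sum_product]
  simp only [Finset.card_filter]

theorem wordAsc_toList_append {S T : Finset V} (hS : IsStable G S) (hT : IsStable G T) :
    wordAsc G (S.toList ++ T.toList) = cross G S T := by
  rw [wordAsc_append, sum_map_countP, wordAsc_eq_zero (by simpa [IsStable] using hS),
    wordAsc_eq_zero (by simpa [IsStable] using hT), zero_add, zero_add]

/-- The exchange on unbalanced components is a bijection from the pairs of sizes (i, j) to those of
sizes (j, i). It preserves the letters and the ascents of the composite word, hence its class in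
`AscMonoid G`. -/
theorem commute_stableSum [Fintype V] (hG : SeparatesNeighbours G) (i j : ℕ) :
    Commute (stableSum (ascHom G) i) (stableSum (ascHom G) j) := by
  classical
  let g : Finset V × Finset V → Finset V × Finset V := fun x =>
    (swapUnbalanced G (x.1 ∪ x.2) x.1 x.2, swapUnbalanced G (x.1 ∪ x.2) x.2 x.1)
  have hgg : ∀ x, g (g x) = x := by
    rintro ⟨S, T⟩
    have hU : (swapUnbalanced G (S ∪ T) S T) ∪ (swapUnbalanced G (S ∪ T) T S) = S ∪ T := by
      ext v
      rw [Finset.mem_union, ← (union_swapUnbalanced (G := G) (S := S) (T := T)).2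
        (fun v => Finset.mem_union) v]
    simp only [g, hU]
    rw [swapUnbalanced_swapUnbalanced, swapUnbalanced_swapUnbalanced]
  have hmem : ∀ i j, ∀ x ∈ stableSets G i ×ˢ stableSets G j,
      g x ∈ stableSets G j ×ˢ stableSets G i := by
    rintro i j ⟨S, T⟩ hx
    simp only [Finset.mem_product, mem_stableSets] at hx
    simp only [g, Finset.mem_product, mem_stableSets, card_swapUnbalanced]
    exact ⟨⟨isStable_swapUnbalanced (fun v => Finset.mem_union) hx.1.1 hx.2.1, hx.2.2⟩,
      isStable_swapUnbalanced (fun v => by rw [Finset.mem_union, or_comm]) hx.2.1 hx.1.1, hx.1.2⟩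
  have hexp : ∀ i j, stableSum (ascHom G) i * stableSum (ascHom G) j =
      ∑ x ∈ stableSets G i ×ˢ stableSets G j,
        ascHom G (Heap.ofSet G x.1 * Heap.ofSet G x.2) := fun i j => by
    simp only [stableSum, Finset.sum_mul_sum, ← Finset.sum_product', map_mul]
  rw [Commute, SemiconjBy, hexp, hexp]
  refine Finset.sum_bij' (fun x _ => g x) (fun x _ => g x) (hmem i j) (hmem j i)
    (fun x _ => hgg x) (fun x _ => hgg x) ?_
  rintro ⟨S, T⟩ hx
  simp only [Finset.mem_product, mem_stableSets] at hx
  obtain ⟨⟨hS, -⟩, hT, -⟩ := hx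
  have hU : ∀ v, v ∈ S ∪ T ↔ v ∈ S ∨ v ∈ T := fun v => Finset.mem_union
  have hU' : ∀ v, v ∈ S ∪ T ↔ v ∈ T ∨ v ∈ S := fun v => (hU v).trans or_comm
  refine congrArg (MonoidAlgebra.of ℚ (AscMonoid G)) ?_
  simp only [g, Heap.ofSet, ← Heap.ofWord_append, toAsc_ofWord]
  refine (Con.eq _).2 ⟨?_, ?_⟩
  · simp only [FreeMonoid.toList_ofList, ← Multiset.coe_eq_coe, ← Multiset.coe_add,
      Finset.coe_toList, val_add_val_swapUnbalanced]
  · simp only [FreeMonoid.toList_ofList]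
    rw [wordAsc_toList_append hS hT, wordAsc_toList_append (isStable_swapUnbalanced hU hS hT)
      (isStable_swapUnbalanced hU' hT hS), cross_swapUnbalanced hG hU hS hT]

end Cross

/-! ### Power sums -/

section PowerSums

variable (B : Type*) [CommSemiring B]

open Classical in
/-- The power sum `∑_i x_i^k`. -/
noncomputable def psum (k : ℕ) : MvPowerSeries ℕ B :=
  fun m => if ∃ i, m = Finsupp.single i k then 1 else 0

open Classical in
theorem coeff_psum (k : ℕ) (m : ℕ →₀ ℕ) :
    MvPowerSeries.coeff m (psum B k) = if ∃ i, m = Finsupp.single i k then 1 else 0 := rfl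

variable {B}

theorem coeff_psum_mul {k : ℕ} (hk : k ≠ 0) (f : MvPowerSeries ℕ B) (m : ℕ →₀ ℕ) :
    MvPowerSeries.coeff m (psum B k * f) = ∑ i ∈ m.support.filter (fun i => k ≤ m i),
      MvPowerSeries.coeff (m - Finsupp.single i k) f := by
  classical
  rw [MvPowerSeries.coeff_mul]
  symm
  refine Finset.sum_of_injOn (fun i => (Finsupp.single i k, m - Finsupp.single i k)) ?_ ?_ ?_ ?_
  · intro i _ j _ h
    exact Finsupp.single_left_injective hk (congrArg Prod.fst h)
  · intro i hi
    have hi' : k ≤ m i := (Finset.mem_filter.1 hi).2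
    rw [Finset.mem_coe, Finset.HasAntidiagonal.mem_antidiagonal]
    exact add_tsub_cancel_of_le (by simpa using hi')
  · rintro ⟨a, b⟩ hab h
    rw [coeff_psum, if_neg, zero_mul]
    rintro ⟨i, hi⟩
    have hab' : a + b = m := Finset.HasAntidiagonal.mem_antidiagonal.1 hab
    dsimp only at hi
    subst hi
    have hki : k ≤ m i := by rw [← hab']; simp
    refine h ⟨i, ?_, ?_⟩
    · simp only [Finset.coe_filter, Finsupp.mem_support_iff, Set.mem_ofPred_eq]
      exact ⟨by omega, hki⟩
    · dsimp only
      rw [← hab', add_tsub_cancel_left]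
  · intro i _
    rw [coeff_psum, if_pos ⟨i, rfl⟩, one_mul]

/-- The power sum `p_λ`. -/
noncomputable def psumMul (B : Type*) [CommSemiring B] (s : Multiset ℕ+) : MvPowerSeries ℕ B :=
  (s.map fun k : ℕ+ => psum B k).prod

/-- These coefficients are natural numbers that do not depend on the base, so they can serve as
scalars in the algebra of the stable set sums and in ℚ[q] alike. -/
theorem coeff_psumMul (s : Multiset ℕ+) (m : ℕ →₀ ℕ) :
    MvPowerSeries.coeff m (psumMul B s) = (MvPowerSeries.coeff m (psumMul ℕ s) : ℕ) := by
  have h1 : ∀ k, MvPowerSeries.map (Nat.castRingHom B) (psum ℕ k) = psum B k := fun k => by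
    ext m
    rw [MvPowerSeries.coeff_map, coeff_psum, coeff_psum]
    split_ifs <;> simp
  have h2 : psumMul B s = MvPowerSeries.map (Nat.castRingHom B) (psumMul ℕ s) := by
    simp only [psumMul, map_multiset_prod, Multiset.map_map, Function.comp_def, h1]
  rw [h2, MvPowerSeries.coeff_map]
  rfl

theorem coeff_psumMul_cons (k : ℕ+) (s : Multiset ℕ+) (m : ℕ →₀ ℕ) :
    MvPowerSeries.coeff m (psumMul B (k ::ₘ s)) =
      ∑ i ∈ m.support.filter (fun i => (k : ℕ) ≤ m i),
        MvPowerSeries.coeff (m - Finsupp.single i (k : ℕ)) (psumMul B s) := by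
  rw [psumMul, Multiset.map_cons, Multiset.prod_cons, coeff_psum_mul k.ne_zero]
  rfl

/-- The sum of the parts. -/
def msize (s : Multiset ℕ+) : ℕ := (s.map fun k : ℕ+ => (k : ℕ)).sum

theorem msize_cons (k : ℕ+) (s : Multiset ℕ+) : msize (k ::ₘ s) = k + msize s := by
  simp [msize]

theorem coeff_psumMul_eq_zero (s : Multiset ℕ+) (m : ℕ →₀ ℕ) (h : msize s ≠ m.degree) :
    MvPowerSeries.coeff m (psumMul B s) = 0 := by
  induction s using Multiset.induction_on generalizing m with
  | empty =>
    classical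
    rw [psumMul, Multiset.map_zero, Multiset.prod_zero, MvPowerSeries.coeff_one, if_neg]
    rintro rfl
    simp [msize] at h
  | cons k s ih =>
    rw [coeff_psumMul_cons]
    refine Finset.sum_eq_zero fun i hi => ih _ fun h' => h ?_
    have hi' : (k : ℕ) ≤ m i := (Finset.mem_filter.1 hi).2
    have h1 : m - Finsupp.single i (k : ℕ) + Finsupp.single i (k : ℕ) = m :=
      tsub_add_cancel_of_le (by simpa using hi')
    have h2 := congrArg Finsupp.degree h1
    rw [map_add, Finsupp.degree_single] at h2
    rw [msize_cons]; omega

theorem finite_msize (n : ℕ) : {s : Multiset ℕ+ | msize s = n}.Finite := by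
  let f : {s : Multiset ℕ+ | msize s = n} → Nat.Partition n := fun s =>
    ⟨s.1.map fun k : ℕ+ => (k : ℕ), fun {i} hi => by
      obtain ⟨k, -, rfl⟩ := Multiset.mem_map.1 hi
      exact k.pos, s.2⟩
  have hf : Function.Injective f := fun s t h => Subtype.ext
    (Multiset.map_injective PNat.coe_injective (congrArg Nat.Partition.parts h))
  have := Finite.of_injective f hf
  exact Set.toFinite _

/-- The multisets of positive integers with sum `n`. -/
noncomputable def mparts (n : ℕ) : Finset (Multiset ℕ+) := (finite_msize n).toFinset

theorem mem_mparts {n : ℕ} {s : Multiset ℕ+} : s ∈ mparts n ↔ msize s = n := by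
  simp [mparts]

/-- `z_λ = ∏_k k^{i_k} i_k!` with `i_k` the multiplicity of the part `k`. -/
def mz (s : Multiset ℕ+) : ℕ := ∏ k ∈ s.toFinset, (k : ℕ) ^ s.count k * (s.count k).factorial

theorem mz_eq_prod {s : Multiset ℕ+} {t : Finset ℕ+} (h : s.toFinset ⊆ t) :
    mz s = ∏ k ∈ t, (k : ℕ) ^ s.count k * (s.count k).factorial := by
  refine Finset.prod_subset h fun k _ hk => ?_
  rw [Multiset.mem_toFinset] at hk
  simp [Multiset.count_eq_zero_of_notMem hk]

theorem mz_cons (k : ℕ+) (s : Multiset ℕ+) : mz (k ::ₘ s) = k * (s.count k + 1) * mz s := by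
  have hk : k ∈ (k ::ₘ s).toFinset := by simp
  rw [mz_eq_prod (subset_refl _), mz_eq_prod (s := s) (t := (k ::ₘ s).toFinset)
    (by simp [Finset.subset_insert]), ← Finset.mul_prod_erase _ _ hk,
    ← Finset.mul_prod_erase _ _ hk]
  have : ∀ j ∈ (k ::ₘ s).toFinset.erase k, (j : ℕ) ^ (k ::ₘ s).count j *
      ((k ::ₘ s).count j).factorial = (j : ℕ) ^ s.count j * (s.count j).factorial := fun j hj => by
    rw [Multiset.count_cons_of_ne (Finset.ne_of_mem_erase hj)]
  rw [Finset.prod_congr rfl this, Multiset.count_cons_self, Nat.factorial_succ]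
  ring

theorem mz_pos (s : Multiset ℕ+) : 0 < mz s :=
  Finset.prod_pos fun k _ => Nat.mul_pos (pow_pos k.pos _) (Nat.factorial_pos _)

/-- `(-1)^{|λ| - ℓ(λ)} / z_λ`. -/
def mweight (s : Multiset ℕ+) : ℚ := (-1) ^ (msize s + Multiset.card s) / mz s

/-- In terms of multiplicities, k i_k / z_λ is 1 / z of λ with one part k removed. This matches the
weights in the recursion on the degree. -/
theorem mweight_cons (k : ℕ+) (s : Multiset ℕ+) :
    (k : ℚ) * ((k ::ₘ s).count k : ℕ) * mweight (k ::ₘ s) = (-1) ^ ((k : ℕ) + 1) * mweight s := by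
  have h1 : (mz s : ℚ) ≠ 0 := by exact_mod_cast (mz_pos s).ne'
  have h2 : ((k : ℕ) : ℚ) ≠ 0 := by exact_mod_cast k.ne_zero
  have h3 : (s.count k : ℚ) + 1 ≠ 0 := by positivity
  rw [mweight, mweight, mz_cons, msize_cons, Multiset.card_cons, Multiset.count_cons_self]
  push_cast
  field_simp
  ring

end PowerSums

/-! ### Elementary functions in terms of power sums -/

section Elementary

/-- The positive integers up to `n`. -/
def posUpTo (n : ℕ) : Finset ℕ+ := (Finset.range n).map ⟨Nat.succPNat, Nat.succPNat_injective⟩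

theorem mem_posUpTo {n : ℕ} {k : ℕ+} : k ∈ posUpTo n ↔ (k : ℕ) ≤ n := by
  simp only [posUpTo, Finset.mem_map, Finset.mem_range, Function.Embedding.coeFn_mk]
  constructor
  · rintro ⟨a, ha, rfl⟩
    simpa using ha
  · intro h
    have := k.pos
    exact ⟨k.natPred, by simp [PNat.natPred]; omega, by simp⟩

variable {A : Type*} [CommRing A] (e π : ℕ → A)

theorem newton_posUpTo (hπ : π 0 = 0)
    (hN : ∀ n : ℕ, (n : A) * e n = ∑ a ∈ Finset.HasAntidiagonal.antidiagonal n,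
      (-1) ^ (a.1 + 1) * (π a.1 * e a.2)) (n : ℕ) :
    (n : A) * e n = ∑ k ∈ posUpTo n, (-1) ^ ((k : ℕ) + 1) * (π k * e (n - k)) := by
  rw [hN, Finset.Nat.sum_antidiagonal_eq_sum_range_succ_mk, Finset.sum_range_succ', hπ]
  simp [posUpTo]

/-- Euler's recursion for a product of values of `e`. -/
theorem degree_mul_prod
    (hN : ∀ n : ℕ, (n : A) * e n =
      ∑ k ∈ posUpTo n, (-1) ^ ((k : ℕ) + 1) * (π k * e (n - k))) (he : e 0 = 1) (m : ℕ →₀ ℕ) :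
    (m.degree : A) * m.prod (fun _ n => e n) = ∑ k ∈ posUpTo m.degree, (-1) ^ ((k : ℕ) + 1) *
      (π k * ∑ i ∈ m.support.filter (fun i => (k : ℕ) ≤ m i),
        (m - Finsupp.single i (k : ℕ)).prod fun _ n => e n) := by
  classical
  -- The degree is the sum of the exponents; Newton's identity is applied to one factor at a time.
  have h1 : ∀ i ∈ m.support, (m i : A) * m.prod (fun _ n => e n) =
      ∑ k ∈ posUpTo (m i), (-1) ^ ((k : ℕ) + 1) * (π k *
        (m - Finsupp.single i (k : ℕ)).prod fun _ n => e n) := by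
    intro i hi
    rw [← Finsupp.mul_prod_erase m i _ hi, ← mul_assoc, hN, Finset.sum_mul]
    refine Finset.sum_congr rfl fun k hk => ?_
    have h2 : (m - Finsupp.single i (k : ℕ)).prod (fun _ n => e n) =
        e (m i - k) * (m.erase i).prod fun _ n => e n := by
      have h3 : (m - Finsupp.single i (k : ℕ)).erase i = m.erase i := by
        ext j
        by_cases hj : j = i
        · simp [hj]
        · simp [Finsupp.erase_ne hj, Ne.symm hj]
      rw [← Finsupp.mul_prod_erase' _ i _ fun _ => he, h3]
      simp
    rw [h2]; ring
  rw [Finsupp.degree_apply, Nat.cast_sum, Finset.sum_mul, Finset.sum_congr rfl h1]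
  simp only [Finset.mul_sum]
  refine Finset.sum_comm' fun i k => ?_
  simp only [mem_posUpTo, Finset.mem_filter]
  constructor
  · rintro ⟨hi, hk⟩
    exact ⟨⟨hi, hk⟩, hk.trans (by rw [← Finsupp.degree_apply]; exact Finsupp.le_degree i m)⟩
  · rintro ⟨h, -⟩; exact h

theorem msize_eq_sum (s : Multiset ℕ+) : msize s = ∑ k ∈ s.toFinset, s.count k * (k : ℕ) := by
  rw [msize, Finset.sum_multiset_map_count]
  simp

/-- Products of elementary functions are combinations of power sums. -/
theorem prod_eq_sum_mparts [Algebra ℚ A]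
    (hN : ∀ n : ℕ, (n : A) * e n =
      ∑ k ∈ posUpTo n, (-1) ^ ((k : ℕ) + 1) * (π k * e (n - k))) (he : e 0 = 1) (m : ℕ →₀ ℕ) :
    m.prod (fun _ n => e n) = ∑ s ∈ mparts m.degree, mweight s •
      ((MvPowerSeries.coeff m (psumMul ℕ s) : ℕ) * (s.map fun k : ℕ+ => π k).prod) := by
  induction hd : m.degree using Nat.strong_induction_on generalizing m with
  | _ d ih =>
  subst hd
  rcases Nat.eq_zero_or_pos m.degree with h0 | hpos
  · obtain rfl : m = 0 := (Finsupp.degree_eq_zero_iff m).1 h0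
    have : mparts 0 = {0} := by
      ext s
      rw [mem_mparts, Finset.mem_singleton]
      refine ⟨fun h => ?_, by rintro rfl; rfl⟩
      induction s using Multiset.induction_on with
      | empty => rfl
      | cons k s _ => rw [msize_cons] at h; have := k.pos; omega
    simp [this, mweight, msize, mz, psumMul]
  have hunit : IsUnit (m.degree : A) := by
    have : (m.degree : A) = algebraMap ℚ A m.degree := by simp
    rw [this]
    exact (IsUnit.mk0 _ (by exact_mod_cast hpos.ne')).map _
  refine hunit.mul_left_cancel ?_
  -- Both sides, multiplied by the degree, become sums of `g` over partitions with a marked part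
  -- value. On one side the marked part is the one split off by the recursion; on the other the
  -- degree is distributed as ∑ k i_k.
  let g : Multiset ℕ+ → ℕ+ → A := fun s k => ((k : ℚ) * (s.count k : ℕ) * mweight s) •
    ((MvPowerSeries.coeff m (psumMul ℕ s) : ℕ) * (s.map fun k : ℕ+ => π k).prod)
  have hR : (m.degree : A) * ∑ s ∈ mparts m.degree, mweight s •
      ((MvPowerSeries.coeff m (psumMul ℕ s) : ℕ) * (s.map fun k : ℕ+ => π k).prod) =
      ∑ x ∈ (mparts m.degree).sigma fun s => s.toFinset, g x.1 x.2 := by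
    rw [Finset.sum_sigma, Finset.mul_sum]
    refine Finset.sum_congr rfl fun s hs => ?_
    simp only [g]
    rw [← Finset.sum_smul, ← Finset.sum_mul, mul_smul, ← nsmul_eq_mul]
    rw [← Nat.cast_smul_eq_nsmul ℚ]
    congr 1
    rw [← mem_mparts.1 hs, msize_eq_sum]
    push_cast
    exact Finset.sum_congr rfl fun k _ => mul_comm _ _
  have hL : (m.degree : A) * m.prod (fun _ n => e n) =
      ∑ x ∈ (posUpTo m.degree).sigma fun k => mparts (m.degree - k), g (x.1 ::ₘ x.2) x.1 := by
    rw [degree_mul_prod e π hN he, Finset.sum_sigma]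
    refine Finset.sum_congr rfl fun k hk => ?_
    have hk' := mem_posUpTo.1 hk
    have h1 : ∀ i ∈ m.support.filter (fun i => (k : ℕ) ≤ m i),
        (m - Finsupp.single i (k : ℕ)).prod (fun _ n => e n) =
          ∑ s ∈ mparts (m.degree - k), mweight s • ((MvPowerSeries.coeff
            (m - Finsupp.single i (k : ℕ)) (psumMul ℕ s) : ℕ) *
              (s.map fun k : ℕ+ => π k).prod) := by
      intro i hi
      have hi' : (k : ℕ) ≤ m i := (Finset.mem_filter.1 hi).2
      have h1 : m - Finsupp.single i (k : ℕ) + Finsupp.single i (k : ℕ) = m :=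
        tsub_add_cancel_of_le (by simpa using hi')
      have h2 := congrArg Finsupp.degree h1
      rw [map_add, Finsupp.degree_single] at h2
      have h3 : (m - Finsupp.single i (k : ℕ)).degree = m.degree - k := by omega
      have := k.pos
      rw [ih _ (by omega) _ rfl, h3]
    rw [Finset.sum_congr rfl h1, Finset.sum_comm, Finset.mul_sum, Finset.mul_sum]
    refine Finset.sum_congr rfl fun s _ => ?_
    simp only [g]
    rw [mweight_cons, coeff_psumMul_cons, Multiset.map_cons, Multiset.prod_cons, Nat.cast_sum,
      ← Finset.smul_sum, ← Finset.sum_mul, mul_smul]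
    rw [show ∀ x : A, (-1 : ℚ) ^ ((k : ℕ) + 1) • x = (-1) ^ ((k : ℕ) + 1) * x from fun x => by
      rw [Algebra.smul_def]; simp]
    congr 1
    rw [mul_smul_comm]
    congr 1
    ring
  rw [hL, hR]
  refine Finset.sum_bij' (fun x _ => ⟨x.1 ::ₘ x.2, x.1⟩) (fun x _ => ⟨x.2, x.1.erase x.2⟩)
    ?_ ?_ ?_ ?_ ?_
  · rintro ⟨k, s⟩ hx
    obtain ⟨hk, hs⟩ := Finset.mem_sigma.1 hx
    have hk' := mem_posUpTo.1 hk
    have hs' := mem_mparts.1 hs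
    dsimp only at hk' hs'
    simp only [Finset.mem_sigma, mem_mparts, msize_cons, Multiset.toFinset_cons,
      Finset.mem_insert_self, and_true]
    omega
  · rintro ⟨s, k⟩ hx
    obtain ⟨hs, hk⟩ := Finset.mem_sigma.1 hx
    have hk' : k ∈ s := by simpa using hk
    have hs' := mem_mparts.1 hs
    dsimp only at hs'
    rw [← Multiset.cons_erase hk', msize_cons] at hs'
    simp only [Finset.mem_sigma, mem_mparts, mem_posUpTo]
    omega
  · rintro ⟨k, s⟩ hx
    simp
  · rintro ⟨s, k⟩ hx
    obtain ⟨hs, hk⟩ := Finset.mem_sigma.1 hx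
    have hk' : k ∈ s := by simpa using hk
    simp [Multiset.cons_erase hk']
  · rintro ⟨k, s⟩ hx
    rfl

end Elementary

/-! ### The logarithms of the series `1 + p̄'_k` -/

section Log

open MvPowerSeries

theorem coeff_geom (k : ℕ+) (i : ℕ) (m : ℕ →₀ ℕ)
    [Decidable (∃ n, m = Finsupp.single i ((k : ℕ) * n))] :
    coeff m (geom k i) = if ∃ n, m = Finsupp.single i ((k : ℕ) * n) then 1 else 0 := by
  classical
  have h1 : ∀ n : ℕ, coeff m (((X i : Series) ^ (k : ℕ)) ^ n) =
      if m = Finsupp.single i ((k : ℕ) * n) then 1 else 0 := fun n => by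
    rw [← pow_mul, X_pow_eq, coeff_monomial]
  have h2 := (summable_geom k i).map_tsum (coeff (R := Coeff) m)
    (WithPiTopology.continuous_coeff Coeff m)
  rw [geom, h2]
  simp only [h1]
  split_ifs with h
  · obtain ⟨n, rfl⟩ := h
    rw [tsum_eq_single n, if_pos rfl]
    intro n' hn'
    rw [if_neg]
    intro h
    have := Finsupp.single_injective i h
    exact hn' (Nat.eq_of_mul_eq_mul_left k.pos this.symm)
  · rw [tsum_congr fun n => if_neg fun e => h ⟨n, e⟩, tsum_zero]

theorem coeff_prod_geom (k : ℕ+) (s : Finset ℕ) (m : ℕ →₀ ℕ)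
    [Decidable (m.support ⊆ s ∧ ∀ i, (k : ℕ) ∣ m i)] :
    coeff m (∏ i ∈ s, geom k i) = if m.support ⊆ s ∧ ∀ i, (k : ℕ) ∣ m i then 1 else 0 := by
  classical
  induction s using Finset.induction_on generalizing m with
  | empty =>
    rw [Finset.prod_empty, coeff_one]
    refine if_congr ?_ rfl rfl
    simp only [Finset.subset_empty, Finsupp.support_eq_empty]
    exact ⟨by rintro rfl; simp, fun h => h.1⟩
  | insert i s hi ih =>
    rw [Finset.prod_insert hi, coeff_mul,
      Finset.sum_eq_single (Finsupp.single i (m i), m.erase i)]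
    · rw [coeff_geom, ih, ite_zero_mul_ite_zero, one_mul]
      refine if_congr ?_ rfl rfl
      constructor
      · rintro ⟨⟨n, hn⟩, hs, hd⟩
        refine ⟨?_, fun j => ?_⟩
        · rw [Finsupp.support_erase] at hs
          exact Finset.subset_insert_iff.2 hs
        · by_cases hj : j = i
          · subst hj
            exact ⟨n, Finsupp.single_injective j hn⟩
          · simpa [hj] using hd j
      · rintro ⟨hs, hd⟩
        obtain ⟨n, hn⟩ := hd i
        refine ⟨⟨n, by rw [hn]⟩, ?_, fun j => ?_⟩
        · rw [Finsupp.support_erase]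
          exact Finset.subset_insert_iff.1 hs
        · by_cases hj : j = i
          · simp [hj]
          · simpa [hj] using hd j
    · rintro ⟨a, b⟩ hab hne
      have hab' : a + b = m := Finset.HasAntidiagonal.mem_antidiagonal.1 hab
      rw [coeff_geom, ih, ite_zero_mul_ite_zero, if_neg]
      rintro ⟨⟨n, hn⟩, hs, -⟩
      dsimp only at hn hs
      have hb : b i = 0 := by
        by_contra hb
        exact hi (hs (Finsupp.mem_support_iff.2 hb))
      have ha : a = Finsupp.single i (m i) := by
        rw [← hab', Finsupp.add_apply, hb, hn]; simp
      refine hne (Prod.ext ha ?_)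
      ext j
      by_cases hj : j = i
      · simp [hj, hb]
      · simp [hj, ← hab', hn]
    · intro h
      refine absurd ?_ h
      rw [Finset.HasAntidiagonal.mem_antidiagonal]
      exact Finsupp.single_add_erase i m

theorem coeff_tprod_geom (k : ℕ+) (m : ℕ →₀ ℕ) [Decidable (∀ i, (k : ℕ) ∣ m i)] :
    coeff m (∏' i, geom k i) = if ∀ i, (k : ℕ) ∣ m i then 1 else 0 := by
  classical
  have h1 : Filter.Tendsto (fun s : Finset ℕ => coeff (R := Coeff) m (∏ i ∈ s, geom k i))
      Filter.atTop (nhds (coeff m (∏' i, geom k i))) :=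
    ((WithPiTopology.continuous_coeff Coeff m).tendsto _).comp (multipliable_geom k).hasProd
  refine tendsto_nhds_unique h1 (tendsto_const_nhds.congr' ?_)
  filter_upwards [Filter.eventually_ge_atTop m.support] with s hs
  rw [coeff_prod_geom]
  refine if_congr ?_ rfl rfl
  simp only [iff_and_self]
  exact fun _ => hs

theorem one_add_pbar (k : ℕ+) : 1 + pbar k = ∏' i, geom k i := by
  rw [pbar]; ring

theorem coeff_pbar (k : ℕ+) (m : ℕ →₀ ℕ) [Decidable (m ≠ 0 ∧ ∀ i, (k : ℕ) ∣ m i)] :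
    coeff m (pbar k) = if m ≠ 0 ∧ ∀ i, (k : ℕ) ∣ m i then 1 else 0 := by
  classical
  rw [pbar, map_sub, coeff_tprod_geom, coeff_one]
  by_cases h : m = 0
  · simp [h]
  · simp [h]

theorem hasSum_logPbar (k : ℕ+) :
    HasSum (fun n : ℕ => PowerSeries.coeff n (PowerSeries.log Coeff) • pbar k ^ n)
      (logPbar k) := by
  rw [WithPiTopology.hasSum_iff_hasSum_coeff]
  intro m
  rw [logPbar, PowerSeries.coeff_subst (hasSubst_pbar k)]
  have := PowerSeries.coeff_subst_finite (hasSubst_pbar k) (PowerSeries.log Coeff) m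
  rw [finsum_eq_sum _ this]
  refine hasSum_sum_of_ne_finset_zero fun n hn => ?_
  rw [coeff_smul]
  by_contra h
  exact hn ((Set.Finite.mem_toFinset _).2 h)

theorem continuous_pderiv (i : ℕ) : Continuous (pderiv Coeff i : Series → Series) := by
  refine continuous_pi fun m => ?_
  change Continuous fun f : Series => coeff m (pderiv Coeff i f)
  simp only [coeff_pderiv]
  exact (continuous_of_discreteTopology (f := fun x : Coeff => x * ((m i : Coeff) + 1))).comp
    (WithPiTopology.continuous_coeff Coeff _)

/-- Differentiating the logarithm termwise gives the geometric series in `-pbar k` times the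
derivative of `pbar k`. -/
theorem one_add_pbar_mul_pderiv (k : ℕ+) (i : ℕ) :
    (1 + pbar k) * pderiv Coeff i (logPbar k) = pderiv Coeff i (pbar k) := by
  have h1 := (hasSum_logPbar k).map (pderiv Coeff i) (continuous_pderiv i)
  have hc : constantCoeff (-pbar k) = 0 := by rw [map_neg, constantCoeff_pbar, neg_zero]
  have h2 := (WithPiTopology.summable_pow_of_constantCoeff_eq_zero hc).hasSum.mul_right
    (pderiv Coeff i (pbar k))
  have h3 := WithPiTopology.one_sub_mul_tsum_pow_of_constantCoeff_eq_zero hc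
  rw [← hasSum_nat_add_iff' 1] at h1
  have h4 := h1.unique (h2.congr_fun fun n => ?_)
  · simp at h4
    rw [h4, ← mul_assoc]
    rw [sub_neg_eq_add] at h3
    rw [h3, one_mul]
  · have hn : algebraMap ℚ Coeff ((-1) ^ (n + 1 + 1) / (n + 1 : ℕ)) * ((n + 1 : ℕ) : Coeff) =
        (-1) ^ n := by
      rw [← map_natCast (algebraMap ℚ Coeff), ← map_mul, div_mul_cancel₀ _ (by positivity),
        pow_add, pow_succ]
      simp
    simp only [Function.comp_apply, PowerSeries.coeff_log, Nat.add_one_ne_zero, if_false]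
    rw [Derivation.map_smul, Derivation.leibniz_pow, Nat.add_sub_cancel,
      ← Nat.cast_smul_eq_nsmul Coeff, smul_smul, hn, smul_eq_mul, smul_eq_C_mul, neg_pow (pbar k)]
    simp [mul_assoc]

open Classical in
/-- The series `∑_{j ≥ 1} (1 / j) ∑_i x_i^{kj}`. -/
noncomputable def logSeries (k : ℕ+) : Series := fun m =>
  -- Here the degree is kj, so the quotient below is 1 / j without a choice of j.
  if ∃ i j, j ≠ 0 ∧ m = Finsupp.single i ((k : ℕ) * j) then
    algebraMap ℚ Coeff ((k : ℕ) / m.degree) else 0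

open Classical in
theorem coeff_logSeries (k : ℕ+) (m : ℕ →₀ ℕ) : coeff m (logSeries k) =
    if ∃ i j, j ≠ 0 ∧ m = Finsupp.single i ((k : ℕ) * j) then
      algebraMap ℚ Coeff ((k : ℕ) / m.degree) else 0 := rfl

open Classical in
theorem coeff_pderiv_logSeries (k : ℕ+) (i : ℕ) (m : ℕ →₀ ℕ) :
    coeff m (pderiv Coeff i (logSeries k)) =
      if ∃ j, m + Finsupp.single i 1 = Finsupp.single i ((k : ℕ) * j) then
        ((k : ℕ) : Coeff) else 0 := by
  rw [coeff_pderiv, coeff_logSeries]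
  by_cases h : ∃ j, m + Finsupp.single i 1 = Finsupp.single i ((k : ℕ) * j)
  · obtain ⟨j, hj⟩ := h
    have hj' : m i + 1 = k * j := by simpa using DFunLike.congr_fun hj i
    have hj0 : j ≠ 0 := by rintro rfl; simp at hj'
    rw [if_pos ⟨i, j, hj0, hj⟩, if_pos ⟨j, hj⟩, hj, Finsupp.degree_single, ← hj']
    have : ((m i : ℕ) : Coeff) + 1 = algebraMap ℚ Coeff ((m i + 1 : ℕ) : ℚ) := by simp
    rw [this, ← map_mul, div_mul_cancel₀ _ (by positivity)]
    simp
  · rw [if_neg h, if_neg, zero_mul]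
    rintro ⟨i', j, hj, he⟩
    by_cases hi : i' = i
    · subst hi; exact h ⟨j, he⟩
    · have := DFunLike.congr_fun he i
      simp [hi] at this

/-- The derivative is k ∑_{j ≥ 1} x_i^{kj-1}, which telescopes to its first term. -/
theorem one_sub_mul_pderiv_logSeries (k : ℕ+) (i : ℕ) :
    (1 - (X i : Series) ^ (k : ℕ)) * pderiv Coeff i (logSeries k) =
      pderiv Coeff i ((X i : Series) ^ (k : ℕ)) := by
  classical
  ext1 m
  rw [sub_mul, one_mul, map_sub, X_pow_eq, coeff_monomial_mul, one_mul,
    coeff_pderiv_logSeries, coeff_pderiv_logSeries, coeff_pderiv, coeff_monomial]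
  by_cases h1 : m + Finsupp.single i 1 = Finsupp.single i (k : ℕ)
  · have hk : m i + 1 = k := by simpa using DFunLike.congr_fun h1 i
    rw [if_pos ⟨1, by rw [mul_one]; exact h1⟩, if_pos h1, if_neg, ← hk]
    · simp
    · rw [Finsupp.single_le_iff]; omega
  · rw [if_neg h1, zero_mul]
    by_cases h2 : Finsupp.single i (k : ℕ) ≤ m
    · rw [if_pos h2, sub_eq_zero]
      refine if_congr ?_ rfl rfl
      have hm : m - Finsupp.single i (k : ℕ) + Finsupp.single i (k : ℕ) = m :=
        tsub_add_cancel_of_le h2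
      constructor
      · rintro ⟨j, hj⟩
        refine ⟨j - 1, ?_⟩
        have hj' : m i + 1 = k * j := by simpa using DFunLike.congr_fun hj i
        obtain ⟨j, rfl⟩ : ∃ j', j = j' + 1 := ⟨j - 1, by
          have : j ≠ 0 := by rintro rfl; simp at hj'
          omega⟩
        refine add_right_cancel (b := Finsupp.single i (k : ℕ)) ?_
        rw [add_right_comm, hm, hj, ← Finsupp.single_add]
        simp [mul_add]
      · rintro ⟨j, hj⟩
        refine ⟨j + 1, ?_⟩
        rw [← hm, add_right_comm, hj, ← Finsupp.single_add, mul_add, mul_one]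
    · rw [if_neg h2, sub_zero, if_neg]
      rintro ⟨j, hj⟩
      have hj' : m i + 1 = k * j := by simpa using DFunLike.congr_fun hj i
      rw [Finsupp.single_le_iff] at h2
      have hj0 : j ≠ 0 := by rintro rfl; simp at hj'
      have hj1 : j = 1 := by
        by_contra hne
        have : 2 ≤ j := by omega
        have := Nat.mul_le_mul_left (k : ℕ) this
        have := k.pos
        omega
      exact h1 (by rw [hj, hj1, mul_one])

/-- The polynomial cancels the only factor of the product that involves x_i. -/
theorem pderiv_one_sub_mul (k : ℕ+) (i : ℕ) :
    pderiv Coeff i ((1 - (X i : Series) ^ (k : ℕ)) * (1 + pbar k)) = 0 := by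
  classical
  ext1 m
  rw [one_add_pbar, coeff_pderiv, sub_mul, one_mul, map_sub, X_pow_eq, coeff_monomial_mul,
    coeff_tprod_geom, coeff_tprod_geom, one_mul]
  have : (if ∀ j, (k : ℕ) ∣ (m + Finsupp.single i 1 : ℕ →₀ ℕ) j then (1 : Coeff) else 0) =
      if Finsupp.single i (k : ℕ) ≤ m + Finsupp.single i 1 then
        if ∀ j, (k : ℕ) ∣ (m + Finsupp.single i 1 - Finsupp.single i (k : ℕ) : ℕ →₀ ℕ) j then 1
        else 0
      else 0 := by
    by_cases h : Finsupp.single i (k : ℕ) ≤ m + Finsupp.single i 1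
    · rw [if_pos h]
      refine if_congr (forall_congr' fun j => ?_) rfl rfl
      by_cases hj : j = i
      · subst hj
        have h' : (k : ℕ) ≤ (m + Finsupp.single j 1 : ℕ →₀ ℕ) j := Finsupp.single_le_iff.1 h
        simp only [Finsupp.tsub_apply, Finsupp.single_eq_same]
        exact (Nat.dvd_sub_iff_left h' dvd_rfl).symm
      · simp [Ne.symm hj]
    · rw [if_neg h, if_neg]
      intro h'
      refine h (Finsupp.single_le_iff.2 (Nat.le_of_dvd ?_ (h' i)))
      simp
  rw [this, sub_self, zero_mul, map_zero]

/-- Both series have constant term zero, so it suffices to compare partial derivatives, after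
multiplication by the nonzero series (1 - x_i^k)(1 + p̄'_k). -/
theorem logPbar_eq (k : ℕ+) : logPbar k = logSeries k := by
  refine pderiv.ext (fun i => ?_) ?_
  · have h1 : (1 - (X i : Series) ^ (k : ℕ)) * (1 + pbar k) ≠ 0 := by
      intro h
      have := congrArg (constantCoeff (R := Coeff)) h
      simp [constantCoeff_pbar] at this
    refine mul_left_cancel₀ h1 ?_
    have h2 := pderiv_one_sub_mul k i
    have h3 := one_sub_mul_pderiv_logSeries k i
    have h4 := one_add_pbar_mul_pderiv k i
    rw [Derivation.leibniz, map_add, map_sub, pderiv_one, zero_sub, smul_eq_mul, smul_eq_mul,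
      zero_add] at h2
    linear_combination (1 - (X i : Series) ^ (k : ℕ)) * h4 + h2 - (1 + pbar k) * h3
  · classical
    rw [logPbar, PowerSeries.constantCoeff_subst_eq_zero (constantCoeff_pbar k) _
      PowerSeries.constantCoeff_log]
    rw [← coeff_zero_eq_constantCoeff_apply, coeff_logSeries, if_neg]
    rintro ⟨i, j, hj, h⟩
    have := DFunLike.congr_fun h i
    simp [hj] at this

/-- The coefficient of x_i^{kj} is (1 / j) ∑_{d ∣ j} μ(d), which vanishes unless j = 1. -/
theorem moebiusLog_eq (k : ℕ+) : moebiusLog k = psum Coeff k := by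
  classical
  ext1 m
  have h1 := (summable_moebiusLog k).hasSum.map (coeff (R := Coeff) m)
    (WithPiTopology.continuous_coeff Coeff m)
  change HasSum _ (coeff m (moebiusLog k)) at h1
  refine h1.unique ?_
  have h2 : ∀ d : ℕ+, (coeff (R := Coeff) m ∘ fun d : ℕ+ =>
      ((ArithmeticFunction.moebius (d : ℕ) : ℚ) / (d : ℕ)) • logPbar (d * k)) d =
      ((ArithmeticFunction.moebius (d : ℕ) : ℚ) / (d : ℕ)) • coeff m (logSeries (d * k)) :=
    fun d => by rw [← logPbar_eq]; rfl
  rw [funext h2, coeff_psum]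
  simp only [coeff_logSeries]
  by_cases hm : ∃ i j, j ≠ 0 ∧ m = Finsupp.single i ((k : ℕ) * j)
  · obtain ⟨i, j, hj, rfl⟩ := hm
    have h3 : ∀ d : ℕ+, (∃ i' j', j' ≠ 0 ∧ Finsupp.single i ((k : ℕ) * j) =
        Finsupp.single i' (((d * k : ℕ+) : ℕ) * j')) ↔ (d : ℕ) ∣ j := by
      intro d
      have hkj : (k : ℕ) * j ≠ 0 := Nat.mul_ne_zero k.ne_zero hj
      constructor
      · rintro ⟨i', j', -, h⟩
        rw [Finsupp.single_eq_single_iff] at h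
        rcases h with ⟨-, h⟩ | ⟨h, -⟩
        · refine ⟨j', Nat.eq_of_mul_eq_mul_left k.pos ?_⟩
          rw [h, PNat.mul_coe]; ring
        · exact absurd h hkj
      · rintro ⟨j', rfl⟩
        refine ⟨i, j', by rintro rfl; simp at hj, ?_⟩
        rw [PNat.mul_coe]; congr 1; ring
    have h4 : (∃ i', Finsupp.single i ((k : ℕ) * j) = Finsupp.single i' (k : ℕ)) ↔ j = 1 := by
      constructor
      · rintro ⟨i', h⟩
        have := congrArg Finsupp.degree h
        rw [Finsupp.degree_single, Finsupp.degree_single] at this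
        simpa using this
      · rintro rfl; exact ⟨i, by simp⟩
    simp only [h3, h4, Finsupp.degree_single]
    have h5 : ∀ d : ℕ+, ((ArithmeticFunction.moebius (d : ℕ) : ℚ) / (d : ℕ)) •
        (if (d : ℕ) ∣ j then algebraMap ℚ Coeff (((d * k : ℕ+) : ℕ) / ((k : ℕ) * j : ℕ)) else 0) =
        if (d : ℕ) ∣ j then algebraMap ℚ Coeff
          ((ArithmeticFunction.moebius (d : ℕ) : ℚ) / j) else 0 := by
      intro d
      split_ifs with h
      · have hk : ((k : ℕ) : ℚ) ≠ 0 := by exact_mod_cast k.ne_zero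
        have hd : ((d : ℕ) : ℚ) ≠ 0 := by exact_mod_cast d.ne_zero
        have hj' : (j : ℚ) ≠ 0 := by exact_mod_cast hj
        rw [Algebra.smul_def, ← map_mul]
        congr 1
        push_cast
        field_simp
      · simp
    simp only [h5]
    have h6 := hasSum_sum_of_ne_finset_zero (f := fun d : ℕ+ => if (d : ℕ) ∣ j then
      algebraMap ℚ Coeff ((ArithmeticFunction.moebius (d : ℕ) : ℚ) / j) else 0)
      (s := posUpTo j) (fun d hd => if_neg fun h => hd (mem_posUpTo.2 (Nat.le_of_dvd (by omega) h)))
      (L := SummationFilter.unconditional _)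
    convert h6 using 1
    have h7 : ∑ d ∈ posUpTo j, (if (d : ℕ) ∣ j then
        algebraMap ℚ Coeff ((ArithmeticFunction.moebius (d : ℕ) : ℚ) / j) else 0) =
        algebraMap ℚ Coeff ((∑ d ∈ j.divisors, ArithmeticFunction.moebius d : ℤ) / j) := by
      rw [← Finset.sum_filter, ← map_sum, ← Finset.sum_div]
      congr 2
      push_cast
      refine Finset.sum_bij (fun d _ => (d : ℕ)) ?_ ?_ ?_ ?_
      · intro d hd
        exact Nat.mem_divisors.2 ⟨(Finset.mem_filter.1 hd).2, hj⟩
      · intro a _ b _ h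
        exact PNat.coe_injective h
      · intro d hd
        have hd' := Nat.dvd_of_mem_divisors hd
        refine ⟨⟨d, Nat.pos_of_mem_divisors hd⟩, Finset.mem_filter.2 ⟨mem_posUpTo.2 ?_, hd'⟩, rfl⟩
        exact Nat.le_of_dvd (by omega) hd'
      · intro d _; rfl
    have h8 : ∑ d ∈ j.divisors, ArithmeticFunction.moebius d = if j = 1 then 1 else 0 := by
      rw [← ArithmeticFunction.coe_mul_zeta_apply, ArithmeticFunction.moebius_mul_coe_zeta,
        ArithmeticFunction.one_apply]
    rw [h7, h8]
    split_ifs with h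
    · simp [h]
    · simp
  · rw [if_neg]
    · convert hasSum_zero with d
      rw [if_neg, smul_zero]
      rintro ⟨i, j, hj, rfl⟩
      exact hm ⟨i, d * j, Nat.mul_ne_zero d.ne_zero hj, by
        rw [PNat.mul_coe]; congr 1; ring⟩
    · rintro ⟨i, rfl⟩
      exact hm ⟨i, 1, one_ne_zero, by rw [mul_one]⟩

end Log

/-! ### Ascents of products of heaps -/

section AscProd

variable {V : Type*} [LinearOrder V] {G : SimpleGraph V}

variable (G) in
open Classical in
/-- The number of ascents between two multisets of pieces. -/
noncomputable def mcross (s t : Multiset V) : ℕ :=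
  (s.map fun u => t.countP fun v => G.Adj u v ∧ u < v).sum

theorem mcross_zero_right (s : Multiset V) : mcross G s 0 = 0 := by
  simp [mcross]

theorem mcross_add_right (s t t' : Multiset V) :
    mcross G s (t + t') = mcross G s t + mcross G s t' := by
  simp [mcross, Multiset.sum_map_add]

theorem mcross_val (S T : Finset V) : mcross G S.val T.val = cross G S T := by
  classical
  rw [← sum_map_countP, ← Finset.coe_toList S, ← Finset.coe_toList T, mcross]
  simp only [Multiset.map_coe, Multiset.sum_coe, Multiset.coe_countP]

theorem Heap.asc_mul (H K : Heap G) : (H * K).asc = H.asc + K.asc + mcross G H.type K.type := by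
  obtain ⟨a, rfl⟩ := H.exists_word
  obtain ⟨b, rfl⟩ := K.exists_word
  rw [← Heap.ofWord_append, Heap.asc_ofWord, Heap.asc_ofWord, Heap.asc_ofWord, wordAsc_append,
    Heap.type_ofWord, Heap.type_ofWord, mcross]
  simp only [Multiset.map_coe, Multiset.sum_coe, Multiset.coe_countP]

theorem Heap.asc_ofSet {S : Finset V} (hS : IsStable G S) : (Heap.ofSet G S).asc = 0 := by
  rw [Heap.ofSet, Heap.asc_ofWord, wordAsc_eq_zero (by simpa [IsStable] using hS)]

theorem mcross_type_prod (s : Multiset V) {n : ℕ} (H : Fin n → Heap G) :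
    mcross G s (List.ofFn H).prod.type = ∑ i, mcross G s (H i).type := by
  induction n with
  | zero => simp [Heap.type_one, mcross_zero_right]
  | succ n ih =>
    rw [List.ofFn_succ, List.prod_cons, Heap.type_mul, mcross_add_right, ih, Fin.sum_univ_succ]

theorem Heap.mem_type_prod {V : Type*} {G : SimpleGraph V} {n : ℕ} (H : Fin n → Heap G) (v : V) :
    v ∈ (List.ofFn H).prod.type ↔ ∃ i, v ∈ (H i).type := by
  induction n with
  | zero => simp [Heap.type_one]
  | succ n ih => rw [List.ofFn_succ, List.prod_cons, Heap.type_mul, Multiset.mem_add, ih,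
      Fin.exists_fin_succ]

theorem asc_prod_ofSet {n : ℕ} (p : Fin n → Finset V) (hp : ∀ i, IsStable G (p i)) :
    (List.ofFn fun i => Heap.ofSet G (p i)).prod.asc =
      ∑ i, ∑ j, if i < j then cross G (p i) (p j) else 0 := by
  induction n with
  | zero => rfl
  | succ n ih =>
    rw [List.ofFn_succ, List.prod_cons, Heap.asc_mul, Heap.asc_ofSet (hp 0),
      ih (fun i => p i.succ) fun i => hp _, mcross_type_prod, Fin.sum_univ_succ]
    simp only [Fin.sum_univ_succ, Heap.type_ofSet, mcross_val]
    simp [add_comm]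

/-- A product of sums over a family of finite sets. -/
theorem prod_ofFn_sum {R X : Type*} [Semiring R] {n : ℕ} (s : Fin n → Finset X)
    (f : Fin n → X → R) : (List.ofFn fun i => ∑ x ∈ s i, f i x).prod =
      ∑ p ∈ Fintype.piFinset s, (List.ofFn fun i => f i (p i)).prod := by
  induction n with
  | zero => simp
  | succ n ih =>
    rw [List.ofFn_succ, List.prod_cons, ih, Finset.sum_mul_sum, ← Finset.sum_product']
    refine Finset.sum_bij' (fun x _ => Fin.cons x.1 x.2) (fun p _ => (p 0, Fin.tail p))
      ?_ ?_ ?_ ?_ ?_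
    · rintro ⟨x, p⟩ hx
      obtain ⟨h1, h2⟩ := Finset.mem_product.1 hx
      rw [Fintype.mem_piFinset] at h2 ⊢
      exact Fin.cases h1 h2
    · intro p hp
      rw [Fintype.mem_piFinset] at hp
      exact Finset.mem_product.2 ⟨hp 0, Fintype.mem_piFinset.2 fun i => hp i.succ⟩
    · rintro ⟨x, p⟩ _
      simp
    · intro p _
      simp
    · rintro ⟨x, p⟩ _
      simp [List.ofFn_succ]

end AscProd

/-! ### The functional that reads off ascents -/

section Functional

variable {V : Type*} [LinearOrder V] {G : SimpleGraph V}

variable (G) in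
open Classical in
/-- `q^{asc}` for a class of words in which every vertex occurs. -/
noncomputable def ascWeight (a : AscMonoid G) : Coeff :=
  Quotient.lift (s := (ascCon G).toSetoid)
    (fun w => if ∀ v, v ∈ FreeMonoid.toList w then
      (Polynomial.X : Coeff) ^ wordAsc G (FreeMonoid.toList w) else 0)
    (fun a b (h : a.toList.Perm b.toList ∧ _) => by
      simp only [h.2, h.1.mem_iff]) a

variable (G) in
/-- The linear functional with `H ↦ q^{asc H}` for the heaps `H` in which every vertex occurs. -/
noncomputable def ascFunctional : MonoidAlgebra ℚ (AscMonoid G) →+ Coeff :=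
  MonoidAlgebra.liftNC (algebraMap ℚ Coeff : ℚ →+ Coeff) (ascWeight G)

theorem ascFunctional_ascHom (H : Heap G) [Decidable (∀ v, v ∈ H.type)] :
    ascFunctional G (ascHom G H) = if ∀ v, v ∈ H.type then Polynomial.X ^ H.asc else 0 := by
  obtain ⟨w, rfl⟩ := H.exists_word
  rw [ascFunctional, ascHom, MonoidHom.comp_apply, MonoidAlgebra.of_apply,
    MonoidAlgebra.liftNC_single, toAsc_ofWord, Heap.asc_ofWord]
  simp only [AddMonoidHom.coe_coe, map_one, one_mul, ascWeight]
  classical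
  refine if_congr (forall_congr' fun v => ?_) rfl rfl
  rw [Heap.type_ofWord]
  rfl

open Classical in
theorem ascFunctional_prod_stableSum [Fintype V] {n : ℕ} (c : Fin n → ℕ) :
    ascFunctional G (List.ofFn fun i => stableSum (ascHom G) (c i)).prod =
      ∑ p ∈ (Fintype.piFinset fun i => stableSets G (c i)).filter (fun p => ∀ v, ∃ i, v ∈ p i),
        Polynomial.X ^ ∑ i, ∑ j, if i < j then cross G (p i) (p j) else 0 := by
  simp only [stableSum]
  rw [prod_ofFn_sum, map_sum, Finset.sum_filter]
  refine Finset.sum_congr rfl fun p hp => ?_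
  have hp' : ∀ i, IsStable G (p i) := fun i => (mem_stableSets.1 (Fintype.mem_piFinset.1 hp i)).1
  have h1 : (List.ofFn fun i => ascHom G (Heap.ofSet G (p i))).prod =
      ascHom G (List.ofFn fun i => Heap.ofSet G (p i)).prod := by
    rw [map_list_prod, List.map_ofFn]; rfl
  rw [h1, ascFunctional_ascHom, asc_prod_ofSet p hp']
  refine if_congr (forall_congr' fun v => ?_) rfl rfl
  rw [Heap.mem_type_prod]
  simp [Heap.type_ofSet]

theorem ascFunctional_prod_pyramidSum [Fintype V] (l : IntPartition) :
    ascFunctional G (List.ofFn fun i => pyramidSum (ascHom G) (l.part i)).prod =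
      pyramidPoly G l := by
  classical
  simp only [pyramidSum]
  rw [prod_ofFn_sum, map_sum, pyramidPoly, finsum_mem_eq_sum_of_inter_support_eq
    (t := (Fintype.piFinset fun i => pyramids G (l.part i)).filter
      (fun P => ∀ v, ∃ i, v ∈ (P i).type)), Finset.sum_filter]
  · refine Finset.sum_congr rfl fun P _ => ?_
    have h1 : (List.ofFn fun i => ascHom G (P i)).prod = ascHom G (List.ofFn P).prod := by
      rw [map_list_prod, List.map_ofFn]; rfl
    rw [h1, ascFunctional_ascHom]
    simp only [Heap.mem_type_prod]
    rfl
  · congr 1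
    ext P
    simp [pyramidLists, mem_pyramids]

end Functional

/-! ### The coefficients of the Kromatic quasisymmetric function -/

section Coefficients

open Classical in
/-- The set colouring with given colour classes. -/
noncomputable def colouringOfClasses {V : Type*} {G : SimpleGraph V} {n : ℕ} (p : Fin n → Finset V)
    (hp : ∀ i, IsStable G (p i)) (hv : ∀ v, ∃ i, v ∈ p i) : SetColouring G :=
  ⟨fun v => (Finset.univ.filter fun i => v ∈ p i).map Fin.valEmbedding,
    fun v => by
      obtain ⟨i, hi⟩ := hv v
      exact ⟨i, Finset.mem_map.2 ⟨i, by simp [hi], rfl⟩⟩,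
    fun u v huv => by
      rw [Finset.disjoint_map, Finset.disjoint_left]
      intro i hi hi'
      exact hp i u (Finset.mem_filter.1 hi).2 v (Finset.mem_filter.1 hi').2 huv⟩

theorem mem_colouringOfClasses {V : Type*} {G : SimpleGraph V} {n : ℕ} {p : Fin n → Finset V}
    {hp : ∀ i, IsStable G (p i)} {hv : ∀ v, ∃ i, v ∈ p i} {v : V} {i : ℕ} :
    i ∈ (colouringOfClasses p hp hv).1 v ↔ ∃ h : i < n, v ∈ p ⟨i, h⟩ := by
  simp only [colouringOfClasses, Finset.mem_map, Finset.mem_filter, Finset.mem_univ, true_and,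
    Fin.valEmbedding_apply]
  constructor
  · rintro ⟨j, hj, rfl⟩; exact ⟨j.2, hj⟩
  · rintro ⟨h, hi⟩; exact ⟨⟨i, h⟩, hi, rfl⟩

variable {V : Type*} [Fintype V] [LinearOrder V] {G : SimpleGraph V}

theorem prod_monomial_one {ι : Type*} (s : Finset ι) (f : ι → ℕ →₀ ℕ) :
    ∏ a ∈ s, (MvPowerSeries.monomial (f a) (1 : Coeff) : Series) =
      MvPowerSeries.monomial (∑ a ∈ s, f a) 1 := by
  classical
  induction s using Finset.induction_on with
  | empty => simp
  | insert a s ha ih =>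
    rw [Finset.prod_insert ha, Finset.sum_insert ha, ih, MvPowerSeries.monomial_mul_monomial,
      one_mul]

open Classical in
theorem SetColouring.coeff_term (κ : SetColouring G) (m : ℕ →₀ ℕ) :
    MvPowerSeries.coeff m κ.term =
      if ∀ i, (Finset.univ.filter fun v => i ∈ κ.1 v).card = m i then
        Polynomial.X ^ κ.asc else 0 := by
  rw [SetColouring.term, MvPowerSeries.coeff_smul]
  simp only [MvPowerSeries.X, prod_monomial_one]
  rw [MvPowerSeries.coeff_monomial, mul_ite, mul_one, mul_zero]
  refine if_congr ?_ rfl rfl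
  rw [DFunLike.ext_iff]
  refine forall_congr' fun i => ?_
  rw [eq_comm]
  have : (∑ v, ∑ j ∈ κ.1 v, Finsupp.single j 1 : ℕ →₀ ℕ) i =
      (Finset.univ.filter fun v => i ∈ κ.1 v).card := by
    rw [Finset.card_filter]
    simp [Finsupp.finsetSum_apply, Finsupp.single_apply]
  rw [this]

theorem asc_colouringOfClasses {n : ℕ} (p : Fin n → Finset V)
    (hp : ∀ i, IsStable G (p i)) (hv : ∀ v, ∃ i, v ∈ p i) :
    (colouringOfClasses p hp hv).asc = ∑ i, ∑ j, if i < j then cross G (p i) (p j) else 0 := by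
  classical
  have h1 : ∀ e : V × V, (((colouringOfClasses p hp hv).1 e.1 ×ˢ
      (colouringOfClasses p hp hv).1 e.2).filter fun c => c.1 < c.2).card =
      ∑ i, ∑ j, if i < j then (if e.1 ∈ p i ∧ e.2 ∈ p j then 1 else 0) else 0 := by
    intro e
    rw [Finset.card_filter, Finset.sum_product]
    simp only [colouringOfClasses, Finset.sum_map, Finset.sum_filter, Fin.valEmbedding_apply,
      Fin.val_fin_lt]
    refine Finset.sum_congr rfl fun i _ => ?_
    split_ifs with h
    · refine Finset.sum_congr rfl fun j _ => ?_
      split_ifs <;> simp_all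
    · simp [h]
  have h2 : ∀ S T : Finset V, cross G S T = ∑ e : V × V with G.Adj e.1 e.2 ∧ e.1 < e.2,
      if e.1 ∈ S ∧ e.2 ∈ T then 1 else 0 := by
    intro S T
    rw [cross, ← Finset.card_filter, Finset.filter_filter]
    congr 1
    ext e
    simp only [Finset.mem_filter, Finset.mem_product, Finset.mem_univ, true_and]
    tauto
  rw [SetColouring.asc]
  simp only [h1, h2]
  rw [Finset.sum_comm]
  refine Finset.sum_congr rfl fun i _ => ?_
  rw [Finset.sum_comm]
  refine Finset.sum_congr rfl fun j _ => ?_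
  split_ifs <;> simp

/-- A colouring with monomial x^m amounts to stable colour classes of sizes m_0, …, m_{n-1} that
cover the vertices. Its ascents go from a class to a later one, just as in the composite heap of the
classes. -/
theorem coeff_kromaticQ (m : ℕ →₀ ℕ) {n : ℕ} (hn : ∀ i, n ≤ i → m i = 0) :
    MvPowerSeries.coeff m (kromaticQ G) =
      ascFunctional G (List.ofFn fun i : Fin n => stableSum (ascHom G) (m i)).prod := by
  classical
  rw [ascFunctional_prod_stableSum]
  have h1 := (SetColouring.summable_term G).hasSum.map (MvPowerSeries.coeff (R := Coeff) m)
    (MvPowerSeries.WithPiTopology.continuous_coeff Coeff m)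
  refine h1.unique ?_
  set F := (Fintype.piFinset fun i : Fin n => stableSets G (m i)).filter
    (fun p => ∀ v, ∃ i, v ∈ p i) with hF
  have hF' : ∀ p ∈ F, (∀ i, IsStable G (p i)) ∧ (∀ i : Fin n, (p i).card = m i) ∧
      ∀ v, ∃ i, v ∈ p i := by
    intro p hp
    rw [hF, Finset.mem_filter, Fintype.mem_piFinset] at hp
    exact ⟨fun i => (mem_stableSets.1 (hp.1 i)).1, fun i => (mem_stableSets.1 (hp.1 i)).2, hp.2⟩
  let g : F → SetColouring G := fun p =>
    colouringOfClasses p.1 (hF' p.1 p.2).1 (hF' p.1 p.2).2.2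
  have hg : Function.Injective g := by
    intro p p' h
    refine Subtype.ext (funext fun i => ?_)
    ext v
    have h2 : (i : ℕ) ∈ (g p).1 v ↔ (i : ℕ) ∈ (g p').1 v := by rw [h]
    simpa only [g, mem_colouringOfClasses, Fin.is_lt, exists_true_left, Fin.eta] using h2
  -- Colourings that do not come from such a tuple of classes have another monomial and contribute
  -- zero.
  rw [← hg.hasSum_iff]
  · rw [← Finset.sum_coe_sort]
    convert hasSum_fintype _ using 1
    · refine Finset.sum_congr rfl fun p _ => ?_
      obtain ⟨h2, h3, h4⟩ := hF' p.1 p.2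
      rw [Function.comp_apply, Function.comp_apply, SetColouring.coeff_term, if_pos,
        asc_colouringOfClasses]
      intro i
      by_cases hi : i < n
      · rw [← h3 ⟨i, hi⟩]
        congr 1
        ext v
        simp [g, mem_colouringOfClasses, hi]
      · rw [hn i (by omega), Finset.card_eq_zero, Finset.filter_eq_empty_iff]
        intro v _
        simp [g, mem_colouringOfClasses, hi]
  · intro κ hκ
    rw [Function.comp_apply, SetColouring.coeff_term, if_neg]
    intro hm
    refine hκ ?_
    have hlt : ∀ v, ∀ i ∈ κ.1 v, i < n := by
      intro v i hi
      by_contra h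
      have := (hm i).trans (hn i (by omega))
      rw [Finset.card_eq_zero, Finset.filter_eq_empty_iff] at this
      exact this (Finset.mem_univ v) hi
    refine ⟨⟨fun i => Finset.univ.filter fun v => (i : ℕ) ∈ κ.1 v, ?_⟩, ?_⟩
    · rw [hF, Finset.mem_filter, Fintype.mem_piFinset]
      refine ⟨fun i => mem_stableSets.2 ⟨?_, hm i⟩, fun v => ?_⟩
      · intro u hu v hv huv
        exact Finset.disjoint_left.1 (κ.2.2 u v huv) (Finset.mem_filter.1 hu).2
          (Finset.mem_filter.1 hv).2
      · obtain ⟨i, hi⟩ := κ.2.1 v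
        exact ⟨⟨i, hlt v i hi⟩, by simp [hi]⟩
    · refine Subtype.ext (funext fun v => ?_)
      ext i
      simp only [g, mem_colouringOfClasses, Finset.mem_filter, Finset.mem_univ, true_and,
        exists_prop]
      exact ⟨fun h => h.2, fun h => ⟨hlt v i h, h⟩⟩

end Coefficients

/-! ### Partitions as multisets -/

namespace IntPartition

/-- A partition is a multiset of positive integers. -/
def equivMultiset : IntPartition ≃ Multiset ℕ+ where
  toFun l := l.parts
  invFun s := ⟨s.sort (· ≥ ·), s.pairwise_sort _⟩
  left_inv l := IntPartition.ext (List.mergeSort_eq_self _ (by simpa using l.sorted))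
  right_inv s := Multiset.sort_eq s _

theorem equivMultiset_apply (l : IntPartition) : equivMultiset l = l.parts := rfl

theorem ofFn_part {X : Type*} (l : IntPartition) (f : ℕ+ → X) :
    List.ofFn (fun i => f (l.part i)) = l.parts.map f := by
  conv_rhs => rw [← List.ofFn_get l.parts, List.map_ofFn]
  rfl

theorem prod_part {X : Type*} [CommMonoid X] (l : IntPartition) (f : ℕ+ → X) :
    ∏ i, f (l.part i) = (l.equivMultiset.map f).prod := by
  rw [← List.prod_ofFn, ofFn_part, equivMultiset_apply, Multiset.map_coe, Multiset.prod_coe]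

theorem size_eq (l : IntPartition) : l.size = msize (equivMultiset l) := by
  rw [size, ← List.sum_ofFn, ofFn_part l (fun k : ℕ+ => (k : ℕ)), msize, equivMultiset_apply,
    Multiset.map_coe, Multiset.sum_coe]

theorem length_eq (l : IntPartition) : l.length = Multiset.card (equivMultiset l) := rfl

theorem length_le_size (l : IntPartition) : l.length ≤ l.size := by
  calc l.length = ∑ _i : Fin l.length, 1 := by simp
    _ ≤ _ := Finset.sum_le_sum fun i _ => (l.part i).pos

theorem signedWeight_eq (l : IntPartition) : l.signedWeight = mweight (equivMultiset l) := by
  -- Sum and difference have the same parity; the sum is free of truncated subtraction.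
  have h1 : (-1 : ℚ) ^ (l.size - l.length) = (-1) ^ (l.size + l.length) := by
    have h : l.size + l.length = l.size - l.length + 2 * l.length := by
      have := l.length_le_size; omega
    rw [h, pow_add, pow_mul]; simp
  have h2 : l.z = mz (equivMultiset l) := by
    simp only [z, mz, equivMultiset_apply, Multiset.coe_count, List.toFinset_coe]
  rw [signedWeight, mweight, h1, h2, size_eq, length_eq]

end IntPartition

/-! ### The expansion in power sums -/

section Expansion

variable {V : Type*} [Fintype V] [LinearOrder V] {G : SimpleGraph V}

/-- Since e_0 = 1, Newton's identity can be solved for π_n recursively. So the pyramid sums inherit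
commutativity from the stable set sums. -/
theorem pyramidSum_mem (n : ℕ) : pyramidSum (ascHom G) n ∈
    Algebra.adjoin ℚ (Set.range (stableSum (ascHom G))) := by
  induction n using Nat.strong_induction_on with
  | _ n ih =>
  have he : ∀ k, stableSum (ascHom G) k ∈ Algebra.adjoin ℚ (Set.range (stableSum (ascHom G))) :=
    fun k => Algebra.subset_adjoin ⟨k, rfl⟩
  have hs : ∀ k : ℕ, ((-1) ^ k : MonoidAlgebra ℚ (AscMonoid G)) ∈
      Algebra.adjoin ℚ (Set.range (stableSum (ascHom G))) :=
    fun k => pow_mem (neg_mem (one_mem _)) k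
  have h := natCast_mul_stableSum (ascHom G) n
  rw [Finset.Nat.sum_antidiagonal_eq_sum_range_succ_mk, Finset.sum_range_succ] at h
  simp only [Nat.sub_self, stableSum_zero, mul_one] at h
  have h' : pyramidSum (ascHom G) n = (-1) ^ (n + 1) * ((n : MonoidAlgebra ℚ (AscMonoid G)) *
      stableSum (ascHom G) n - ∑ k ∈ Finset.range n, (-1) ^ (k + 1) *
        (pyramidSum (ascHom G) k * stableSum (ascHom G) (n - k))) := by
    rw [h, add_sub_cancel_left, ← mul_assoc, ← pow_add, Even.neg_one_pow (by simp), one_mul]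
  rw [h']
  refine mul_mem (hs _) (sub_mem (mul_mem (natCast_mem _ _) (he _)) (sum_mem fun k hk => ?_))
  exact mul_mem (hs _) (mul_mem (ih k (Finset.mem_range.1 hk)) (he _))

open scoped IsMulCommutative in
/-- The coefficients of the Kromatic quasisymmetric function in terms of power sums. -/
theorem coeff_kromaticQ_eq_sum (hG : SeparatesNeighbours G) (m : ℕ →₀ ℕ) :
    MvPowerSeries.coeff m (kromaticQ G) = ∑ s ∈ mparts m.degree, mweight s •
      ((MvPowerSeries.coeff m (psumMul ℕ s) : ℕ) *
        pyramidPoly G (IntPartition.equivMultiset.symm s)) := by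
  classical
  set A := Algebra.adjoin ℚ (Set.range (stableSum (ascHom G))) with hA
  have hcomm : IsMulCommutative A := Algebra.isMulCommutative_adjoin ℚ (by
    rintro _ ⟨i, rfl⟩ _ ⟨j, rfl⟩
    exact commute_stableSum hG i j)
  let e : ℕ → A := fun n => ⟨stableSum (ascHom G) n, Algebra.subset_adjoin ⟨n, rfl⟩⟩
  let π : ℕ → A := fun n => ⟨pyramidSum (ascHom G) n, pyramidSum_mem n⟩
  have he : e 0 = 1 := Subtype.ext (stableSum_zero _)
  have hπ : π 0 = 0 := Subtype.ext (pyramidSum_zero _)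
  have hN : ∀ n : ℕ, (n : A) * e n = ∑ a ∈ Finset.HasAntidiagonal.antidiagonal n,
      (-1) ^ (a.1 + 1) * (π a.1 * e a.2) := fun n => Subtype.ext (by
    have := natCast_mul_stableSum (ascHom G) n
    simpa using this)
  have key := prod_eq_sum_mparts e π (newton_posUpTo e π hπ hN) he m
  obtain ⟨n, hn⟩ : ∃ n, ∀ i, n ≤ i → m i = 0 := by
    obtain ⟨n, hn⟩ := m.support.exists_nat_subset_range
    refine ⟨n, fun i hi => ?_⟩
    by_contra h
    have := Finset.mem_range.1 (hn (Finsupp.mem_support_iff.2 h))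
    omega
  have hprod : m.prod (fun _ n => e n) = (List.ofFn fun i : Fin n => e (m i)).prod := by
    rw [List.prod_ofFn, Fin.prod_univ_eq_prod_range (fun i => e (m i)),
      Finsupp.prod_of_support_subset m (s := Finset.range n) _ _ (fun i _ => he)]
    intro i hi
    by_contra h
    exact (Finsupp.mem_support_iff.1 hi) (hn i (by simpa using h))
  rw [coeff_kromaticQ m hn]
  -- The identity holds in the commutative subalgebra; only now are the ascents read off by the
  -- linear functional.
  have h1 := congrArg (fun x => ascFunctional G (A.val x)) (hprod.symm.trans key)
  rw [map_list_prod, List.map_ofFn, map_sum, map_sum] at h1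
  refine Eq.trans ?_ (h1.trans (Finset.sum_congr rfl fun s _ => ?_))
  · rfl
  · rw [map_smul, map_rat_smul, map_mul, map_natCast]
    congr 1
    rw [← nsmul_eq_mul, map_nsmul, nsmul_eq_mul, ← ascFunctional_prod_pyramidSum]
    congr 2
    conv_lhs => rw [← IntPartition.equivMultiset.apply_symm_apply s]
    rw [IntPartition.equivMultiset_apply, Multiset.map_coe, Multiset.prod_coe, map_list_prod,
      List.map_map,
      IntPartition.ofFn_part _ (fun k : ℕ+ => pyramidSum (ascHom G) (k : ℕ))]
    rfl

theorem IntPartition.prod_moebiusLog (l : IntPartition) :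
    ∏ i, moebiusLog (l.part i) = psumMul Coeff (equivMultiset l) := by
  rw [IntPartition.prod_part]
  simp only [moebiusLog_eq, psumMul]

theorem hasSum_kromaticQ (hG : SeparatesNeighbours G) :
    HasSum (fun l : IntPartition => (l.signedWeight • pyramidPoly G l) •
      ∏ i : Fin l.length, moebiusLog (l.part i)) (kromaticQ G) := by
  rw [MvPowerSeries.WithPiTopology.hasSum_iff_hasSum_coeff]
  intro m
  rw [coeff_kromaticQ_eq_sum hG, ← IntPartition.equivMultiset.symm.hasSum_iff]
  have h : ∀ s : Multiset ℕ+, mweight s • ((MvPowerSeries.coeff m (psumMul ℕ s) : ℕ) *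
      pyramidPoly G (IntPartition.equivMultiset.symm s)) =
      MvPowerSeries.coeff m (((IntPartition.equivMultiset.symm s).signedWeight •
        pyramidPoly G (IntPartition.equivMultiset.symm s)) •
        ∏ i, moebiusLog ((IntPartition.equivMultiset.symm s).part i)) := by
    intro s
    rw [MvPowerSeries.coeff_smul, IntPartition.prod_moebiusLog, IntPartition.signedWeight_eq,
      Equiv.apply_symm_apply, coeff_psumMul (B := Coeff), smul_mul_assoc, mul_comm]
  simp only [h]
  refine hasSum_sum_of_ne_finset_zero fun s hs => ?_
  rw [Function.comp_apply, ← h, coeff_psumMul_eq_zero (B := ℕ)]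
  · simp
  · intro e; exact hs (mem_mparts.2 e)

end Expansion

/-! ### Uniqueness of the expansion -/

section Uniqueness

open MvPowerSeries

variable {B : Type*} [CommSemiring B] {ι : Type*}

theorem exists_coeff_ne_zero_of_prod (s : Finset ι) (f : ι → MvPowerSeries ℕ B) (m : ℕ →₀ ℕ)
    (h : coeff m (∏ i ∈ s, f i) ≠ 0) :
    ∃ a : ι → ℕ →₀ ℕ, ∑ i ∈ s, a i = m ∧ ∀ i ∈ s, coeff (a i) (f i) ≠ 0 := by
  classical
  induction s using Finset.induction_on generalizing m with
  | empty =>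
    rw [Finset.prod_empty, coeff_one] at h
    exact ⟨0, by simpa using (ite_ne_right_iff.1 h).1.symm, by simp⟩
  | insert i s hi ih =>
    rw [Finset.prod_insert hi, coeff_mul] at h
    obtain ⟨⟨a, b⟩, hab, hne⟩ := Finset.exists_ne_zero_of_sum_ne_zero h
    obtain ⟨c, hc, hc'⟩ := ih b (right_ne_zero_of_mul hne)
    have hab' : a + b = m := Finset.HasAntidiagonal.mem_antidiagonal.1 hab
    have hu : ∀ j ∈ s, Function.update c i a j = c j := fun j hj =>
      Function.update_of_ne (ne_of_mem_of_not_mem hj hi) _ _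
    refine ⟨Function.update c i a, ?_, fun j hj => ?_⟩
    · rw [Finset.sum_insert hi, Function.update_self, Finset.sum_congr rfl hu, hc, hab']
    · rcases Finset.mem_insert.1 hj with rfl | hj
      · rw [Function.update_self]; exact left_ne_zero_of_mul hne
      · rw [hu j hj]; exact hc' j hj

theorem coeff_prod_pos (s : Finset ι) (f : ι → MvPowerSeries ℕ ℕ) (a : ι → ℕ →₀ ℕ)
    (h : ∀ i ∈ s, 0 < coeff (a i) (f i)) : 0 < coeff (∑ i ∈ s, a i) (∏ i ∈ s, f i) := by
  classical
  induction s using Finset.induction_on with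
  | empty => simp
  | insert i s hi ih =>
    rw [Finset.prod_insert hi, Finset.sum_insert hi, coeff_mul]
    refine Finset.sum_pos' (fun _ _ => Nat.zero_le _) ⟨(a i, ∑ j ∈ s, a j), ?_, ?_⟩
    · exact Finset.HasAntidiagonal.mem_antidiagonal.2 rfl
    · exact Nat.mul_pos (h i (by simp)) (ih fun j hj => h j (by simp [hj]))

open Classical in
/-- `p̄'_k` with coefficients in `ℕ`. -/
noncomputable def pbarNat (k : ℕ+) : MvPowerSeries ℕ ℕ :=
  fun m => if m ≠ 0 ∧ ∀ i, (k : ℕ) ∣ m i then 1 else 0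

open Classical in
theorem coeff_pbarNat (k : ℕ+) (m : ℕ →₀ ℕ) :
    coeff m (pbarNat k) = if m ≠ 0 ∧ ∀ i, (k : ℕ) ∣ m i then 1 else 0 := rfl

theorem map_pbarNat (k : ℕ+) : map (Nat.castRingHom Coeff) (pbarNat k) = pbar k := by
  classical
  ext1 m
  rw [coeff_map, coeff_pbarNat, coeff_pbar]
  split_ifs <;> simp

/-- The monomial `x_0^{λ_1} x_1^{λ_2} ⋯`. -/
noncomputable def IntPartition.exponent (l : IntPartition) : ℕ →₀ ℕ :=
  ∑ i : Fin l.length, Finsupp.single (i : ℕ) (l.part i : ℕ)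

theorem IntPartition.degree_exponent (l : IntPartition) : l.exponent.degree = l.size := by
  simp [exponent, size, map_sum]

theorem IntPartition.exponent_apply (l : IntPartition) (i : Fin l.length) :
    l.exponent i = l.part i := by
  rw [exponent, Finsupp.finsetSum_apply, Finset.sum_eq_single i]
  · simp
  · intro j _ hj
    rw [Finsupp.single_eq_of_ne]
    exact fun e => hj (Fin.ext e.symm)
  · simp

theorem IntPartition.exponent_eq_zero (l : IntPartition) {i : ℕ} (h : l.length ≤ i) :
    l.exponent i = 0 := by
  rw [exponent, Finsupp.finsetSum_apply]
  refine Finset.sum_eq_zero fun j _ => ?_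
  rw [Finsupp.single_eq_of_ne]
  have := j.2
  omega

/-- The coefficients are natural numbers, so nothing cancels, and taking x_i^{λ_{i+1}} from each
factor, with i starting at 0, already gives a positive contribution. -/
theorem IntPartition.coeff_exponent_pbar_ne_zero (l : IntPartition) :
    coeff l.exponent l.pbar ≠ 0 := by
  classical
  have h1 : l.pbar = map (Nat.castRingHom Coeff) (∏ i, pbarNat (l.part i)) := by
    simp only [pbar, map_prod, map_pbarNat]
  rw [h1, coeff_map]
  have h2 : 0 < coeff l.exponent (∏ i, pbarNat (l.part i)) := by
    refine coeff_prod_pos _ _ _ fun i _ => ?_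
    rw [coeff_pbarNat, if_pos]
    · exact Nat.one_pos
    · refine ⟨?_, fun j => ?_⟩
      · rw [Finsupp.single_ne_zero]; exact (l.part i).ne_zero
      · rw [Finsupp.single_apply]
        split_ifs <;> simp
  simpa using h2.ne'

theorem eq_single_of_dvd {k : ℕ} {a : ℕ →₀ ℕ} (ha : a ≠ 0) (hk : ∀ i, k ∣ a i)
    (hd : a.degree = k) : ∃ j, a = Finsupp.single j k := by
  obtain ⟨j, hj⟩ := Finsupp.ne_iff.1 ha
  have h1 : k ≤ a j := Nat.le_of_dvd (Nat.pos_of_ne_zero hj) (hk j)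
  have h2 : Finsupp.single j k ≤ a := Finsupp.single_le_iff.2 h1
  refine ⟨j, ?_⟩
  have h3 : a - Finsupp.single j k + Finsupp.single j k = a := tsub_add_cancel_of_le h2
  have h4 := congrArg Finsupp.degree h3
  rw [map_add, Finsupp.degree_single, hd] at h4
  have h5 : a - Finsupp.single j k = 0 := (Finsupp.degree_eq_zero_iff _).1 (by omega)
  rw [h5, zero_add] at h3
  exact h3.symm

theorem le_degree_of_dvd {k : ℕ} {a : ℕ →₀ ℕ} (ha : a ≠ 0) (hk : ∀ i, k ∣ a i) :
    k ≤ a.degree := by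
  obtain ⟨j, hj⟩ := Finsupp.ne_iff.1 ha
  exact (Nat.le_of_dvd (Nat.pos_of_ne_zero hj) (hk j)).trans (Finsupp.le_degree j a)

/-- The expansion of `p̄'_λ` in monomials is triangular. -/
theorem IntPartition.eq_of_coeff_ne_zero {l k : IntPartition} (h : coeff k.exponent l.pbar ≠ 0)
    (hs : k.size ≤ l.size) (hl : l.size = k.size → l.length ≤ k.length) : l = k := by
  classical
  obtain ⟨a, ha, ha'⟩ := exists_coeff_ne_zero_of_prod _ _ _ h
  have h1 : ∀ i, a i ≠ 0 ∧ ∀ j, (l.part i : ℕ) ∣ a i j := fun i => by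
    have := ha' i (Finset.mem_univ i)
    rw [coeff_pbar] at this
    exact (ite_ne_right_iff.1 this).1
  have h2 : ∀ i ∈ Finset.univ, (l.part i : ℕ) ≤ (a i).degree := fun i _ =>
    le_degree_of_dvd (h1 i).1 (h1 i).2
  have h3 : ∑ i, (a i).degree = k.size := by rw [← map_sum, ha, degree_exponent]
  have h4 : l.size ≤ k.size := by rw [← h3]; exact Finset.sum_le_sum h2
  have h5 : ∑ i, (l.part i : ℕ) = ∑ i, (a i).degree := by
    rw [h3]; exact le_antisymm h4 hs
  -- The factor of λ_i contributes degree at least λ_i, and the total leaves no slack, so it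
  -- contributes a pure power x_j^{λ_i}.
  have h6 := (Finset.sum_eq_sum_iff_of_le h2).1 h5
  choose j hj using fun i => eq_single_of_dvd (h1 i).1 (h1 i).2 (h6 i (Finset.mem_univ i)).symm
  have hsum : ∀ x, k.exponent x = ∑ i, if j i = x then (l.part i : ℕ) else 0 := by
    intro x
    rw [← ha, Finsupp.finsetSum_apply]
    refine Finset.sum_congr rfl fun i _ => ?_
    rw [hj i, Finsupp.single_apply]
  have hlt : ∀ i, j i < k.length := by
    intro i
    by_contra hge
    have := k.exponent_eq_zero (not_lt.1 hge)
    rw [hsum, Finset.sum_eq_zero_iff] at this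
    have := this i (Finset.mem_univ i)
    simp at this
  let e : Fin l.length → Fin k.length := fun i => ⟨j i, hlt i⟩
  have hsurj : Function.Surjective e := by
    intro y
    have hy : k.exponent y ≠ 0 := by rw [exponent_apply]; exact (k.part y).ne_zero
    rw [hsum] at hy
    obtain ⟨i, -, hi⟩ := Finset.exists_ne_zero_of_sum_ne_zero hy
    exact ⟨i, Fin.ext (ite_ne_right_iff.1 hi).1⟩
  have hcard : l.length = k.length := by
    have := Fintype.card_le_of_surjective e hsurj
    rw [Fintype.card_fin, Fintype.card_fin] at this
    exact le_antisymm (hl (le_antisymm h4 hs)) this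
  have hbij : Function.Bijective e :=
    (Fintype.bijective_iff_surjective_and_card e).2 ⟨hsurj, by simp [hcard]⟩
  have hpart : ∀ i, l.part i = k.part (e i) := by
    intro i
    refine PNat.coe_injective ?_
    rw [← exponent_apply k, hsum, Finset.sum_eq_single i]
    · simp [e]
    · intro i' _ hi'
      rw [if_neg]
      intro he
      exact hi' (hbij.1 (Fin.ext he))
    · simp
  refine equivMultiset.injective ?_
  have hm : ∀ l : IntPartition, equivMultiset l = Finset.univ.val.map l.part := by
    intro l
    rw [equivMultiset_apply, ← List.map_id l.parts, ← ofFn_part l id, Fin.univ_val_map]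
    rfl
  rw [hm, hm, funext hpart, ← Function.comp_def k.part e, ← Multiset.map_map]
  congr 1
  have := Finset.map_univ_equiv (Equiv.ofBijective e hbij)
  exact congrArg Finset.val this

theorem finite_size_eq (n : ℕ) : {l : IntPartition | l.size = n}.Finite := by
  refine ((finite_msize n).preimage IntPartition.equivMultiset.injective.injOn).subset
    fun l hl => ?_
  exact (IntPartition.size_eq l).symm.trans hl

/-- A series has at most one expansion in the `p̄'_λ`. -/
theorem hasSum_pbar_unique {c c' : IntPartition → Coeff} {f : Series}
    (hc : HasSum (fun l : IntPartition => c l • l.pbar) f)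
    (hc' : HasSum (fun l : IntPartition => c' l • l.pbar) f) : c = c' := by
  classical
  have h0 : HasSum (fun l : IntPartition => (c l - c' l) • l.pbar) 0 := by
    simpa only [sub_smul, sub_self] using hc.sub hc'
  by_contra hne
  obtain ⟨l₀, hl₀⟩ := Function.ne_iff.1 hne
  have hex : ∃ n, ∃ l : IntPartition, c l - c' l ≠ 0 ∧ l.size = n :=
    ⟨_, l₀, sub_ne_zero.2 hl₀, rfl⟩
  have hfin : {l : IntPartition | c l - c' l ≠ 0 ∧ l.size = Nat.find hex}.Finite :=
    (finite_size_eq (Nat.find hex)).subset fun l hl => hl.2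
  obtain ⟨l₁, hl₁⟩ := Nat.find_spec hex
  -- Among the partitions of least size where the expansions differ, one of greatest length is
  -- taken. By triangularity no other difference reaches its monomial.
  obtain ⟨k, hk, hmax⟩ := hfin.exists_maximalFor IntPartition.length _ ⟨l₁, hl₁⟩
  have h1 := h0.map (coeff (R := Coeff) k.exponent)
    (WithPiTopology.continuous_coeff Coeff k.exponent)
  rw [map_zero] at h1
  have h2 := h1.unique (hasSum_single k fun l hl => ?_)
  · rw [Function.comp_apply, coeff_smul] at h2
    exact mul_ne_zero hk.1 k.coeff_exponent_pbar_ne_zero h2.symm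
  · rw [Function.comp_apply, coeff_smul]
    by_contra hne
    have hd := left_ne_zero_of_mul hne
    refine hl (IntPartition.eq_of_coeff_ne_zero (right_ne_zero_of_mul hne) ?_ fun hs => ?_)
    · rw [hk.2]
      exact Nat.find_min' hex ⟨l, hd, rfl⟩
    · by_contra hlt
      exact hlt (hmax ⟨hd, hs.trans hk.2⟩ (not_le.1 hlt).le)

end Uniqueness

/-! ### The expansion in the `p̄'_λ` -/

section Existence

open MvPowerSeries

theorem summable_mul {X Y : Type*} {f : X → Series} {g : Y → Series} (hf : Summable f)
    (hg : Summable g) : Summable fun x : X × Y => f x.1 * g x.2 := by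
  classical
  rw [WithPiTopology.summable_iff_summable_coeff] at hf hg ⊢
  intro m
  have hfin : (⋃ a ∈ Finset.HasAntidiagonal.antidiagonal m,
      (Function.support fun x => coeff a.1 (f x)) ×ˢ
        (Function.support fun y => coeff a.2 (g y))).Finite :=
    Set.Finite.biUnion (Finset.finite_toSet _) fun a _ =>
      (hf a.1).hasFiniteSupport_of_discreteTopology.prod
        (hg a.2).hasFiniteSupport_of_discreteTopology
  refine summable_of_hasFiniteSupport (hfin.subset fun x hx => ?_)
  rw [Function.mem_support, coeff_mul] at hx
  obtain ⟨a, ha, hne⟩ := Finset.exists_ne_zero_of_sum_ne_zero hx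
  simp only [Set.mem_iUnion]
  exact ⟨a, ha, left_ne_zero_of_mul hne, right_ne_zero_of_mul hne⟩

theorem hasSum_mul {X Y : Type*} {f : X → Series} {g : Y → Series} {a b : Series}
    (hf : HasSum f a) (hg : HasSum g b) : HasSum (fun x : X × Y => f x.1 * g x.2) (a * b) :=
  HasSum.mul hf hg (summable_mul hf.summable hg.summable)

theorem hasSum_prod_fin {X : Type*} {n : ℕ} {f : Fin n → X → Series} {a : Fin n → Series}
    (h : ∀ i, HasSum (f i) (a i)) :
    HasSum (fun x : Fin n → X => ∏ i, f i (x i)) (∏ i, a i) := by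
  induction n with
  | zero => simp
  | succ n ih =>
    rw [Fin.prod_univ_succ, ← (Fin.consEquiv fun _ => X).hasSum_iff]
    have h1 := ih fun i : Fin n => h i.succ
    have h2 := hasSum_mul (h 0) h1
    have e : (fun x : Fin (n + 1) → X => ∏ i, f i (x i)) ∘ (Fin.consEquiv fun _ => X) =
        fun x : X × (Fin n → X) => f 0 x.1 * ∏ i, f i.succ (x.2 i) := by
      funext x
      simp [Fin.prod_univ_succ, Fin.consEquiv]
    rw [e]
    exact h2

/-- The product of the `p̄'_k` over a multiset. -/
noncomputable def mpbar (s : Multiset ℕ+) : Series := (s.map pbar).prod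

theorem IntPartition.pbar_eq (l : IntPartition) : l.pbar = mpbar (equivMultiset l) :=
  l.prod_part Kromatic.pbar

theorem le_order_mpbar (s : Multiset ℕ+) : (msize s : ℕ∞) ≤ (mpbar s).order := by
  induction s using Multiset.induction_on with
  | empty => simp [msize]
  | cons k s ih =>
    rw [msize_cons, mpbar, Multiset.map_cons, Multiset.prod_cons, Nat.cast_add]
    exact (add_le_add (le_order_pbar k) ih).trans le_order_mul

theorem coeff_mpbar_eq_zero {s : Multiset ℕ+} {m : ℕ →₀ ℕ} (h : m.degree < msize s) :
    coeff m (mpbar s) = 0 :=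
  coeff_of_lt_order (lt_of_lt_of_le (by exact_mod_cast h) (le_order_mpbar s))

/-- The weight `μ(d) (-1)^{n+1} / (d n)`. -/
noncomputable def logWeight (x : ℕ+ × ℕ+) : ℚ :=
  (ArithmeticFunction.moebius (x.1 : ℕ) : ℚ) * (-1) ^ ((x.2 : ℕ) + 1) / ((x.1 : ℕ) * (x.2 : ℕ))

theorem hasSum_logPbar_pnat (k : ℕ+) :
    HasSum (fun n : ℕ+ => ((-1) ^ ((n : ℕ) + 1) / (n : ℕ) : ℚ) • pbar k ^ (n : ℕ))
      (logPbar k) := by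
  have h := hasSum_logPbar k
  rw [← PNat.coe_injective.hasSum_iff] at h
  · convert h using 2 with n
    rw [Function.comp_apply, PowerSeries.coeff_log, if_neg n.ne_zero, algebraMap_smul]
  · intro n hn
    have : n = 0 := by
      by_contra h0
      exact hn ⟨⟨n, Nat.pos_of_ne_zero h0⟩, rfl⟩
    simp [this]

theorem mpbar_replicate (n : ℕ) (k : ℕ+) : mpbar (Multiset.replicate n k) = pbar k ^ n := by
  simp [mpbar]

theorem msize_replicate (n : ℕ) (k : ℕ+) : msize (Multiset.replicate n k) = n * k := by
  simp [msize]

/-- The order of p̄'_{dk}^n is at least ndk, so a given coefficient meets only finitely many pairs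
(d, n), and the iterated sum may be taken as one sum over pairs. -/
theorem hasSum_moebiusLog (k : ℕ+) :
    HasSum (fun x : ℕ+ × ℕ+ => logWeight x • pbar (x.1 * k) ^ (x.2 : ℕ)) (moebiusLog k) := by
  have h1 : ∀ d : ℕ+, HasSum (fun n : ℕ+ => logWeight (d, n) • pbar (d * k) ^ (n : ℕ))
      (((ArithmeticFunction.moebius (d : ℕ) : ℚ) / (d : ℕ)) • logPbar (d * k)) := by
    intro d
    have h := (hasSum_logPbar_pnat (d * k)).mul_left
      (algebraMap ℚ Series ((ArithmeticFunction.moebius (d : ℕ) : ℚ) / (d : ℕ)))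
    rw [← Algebra.smul_def] at h
    refine (congrArg (HasSum · _) (funext fun n => ?_)).mp h
    rw [← Algebra.smul_def, smul_smul, logWeight, div_mul_div_comm]
  have hs : Summable fun x : (_ : ℕ+) × ℕ+ =>
      logWeight (x.1, x.2) • pbar (x.1 * k) ^ (x.2 : ℕ) := by
    rw [WithPiTopology.summable_iff_summable_coeff]
    intro m
    refine summable_of_hasFiniteSupport (Set.Finite.subset
      (((posUpTo m.degree).sigma fun _ => posUpTo m.degree).finite_toSet) fun x hx => ?_)
    have hle : (x.2 : ℕ) * ((x.1 : ℕ) * (k : ℕ)) ≤ m.degree := by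
      by_contra hlt
      refine hx ?_
      change coeff m (_ • _) = 0
      rw [← mpbar_replicate, ← algebraMap_smul Coeff, coeff_smul, coeff_mpbar_eq_zero, mul_zero]
      rw [msize_replicate, PNat.mul_coe]
      exact not_le.1 hlt
    have h1 := Nat.le_of_dvd (Nat.mul_pos x.2.pos (Nat.mul_pos x.1.pos k.pos))
      (Dvd.intro _ rfl : (x.2 : ℕ) ∣ (x.2 : ℕ) * ((x.1 : ℕ) * (k : ℕ)))
    have h2 := Nat.le_of_dvd (Nat.mul_pos x.2.pos (Nat.mul_pos x.1.pos k.pos))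
      ((Dvd.intro _ rfl : (x.1 : ℕ) ∣ (x.1 : ℕ) * (k : ℕ)).mul_left _)
    simp only [Finset.mem_coe, Finset.mem_sigma, mem_posUpTo]
    exact ⟨h2.trans hle, h1.trans hle⟩
  have h := HasSum.sigma_of_hasSum (summable_moebiusLog k).hasSum h1 hs
  exact (Equiv.sigmaEquivProd ℕ+ ℕ+).hasSum_iff.1 h

namespace Blowup

/-- A blow-up is a partition with a pair of positive integers for each part. -/
def equivSigma : Blowup ≃ (l : IntPartition) × (Fin l.length → ℕ+ × ℕ+) where
  toFun t := ⟨t.base, fun i => (t.d i, t.n i)⟩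
  invFun x := ⟨x.1, fun i => (x.2 i).1, fun i => (x.2 i).2⟩
  left_inv _ := rfl
  right_inv _ := rfl

theorem mpbar_list (t : Blowup) :
    mpbar t.list = ∏ i, pbar (t.d i * t.base.part i) ^ (t.n i : ℕ) := by
  rw [mpbar, Multiset.map_coe, Multiset.prod_coe, list, List.map_flatten, List.prod_flatten,
    List.map_map, List.map_ofFn, List.prod_ofFn]
  simp

/-- The partition `(dλ')^n`. -/
def partition (t : Blowup) : IntPartition := IntPartition.equivMultiset.symm t.list

theorem mem_fiber_iff (t : Blowup) (l : IntPartition) : t ∈ fiber l ↔ t.partition = l := by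
  rw [partition, Equiv.symm_apply_eq, IntPartition.equivMultiset_apply, Multiset.coe_eq_coe]
  rfl

variable {V : Type*} [LinearOrder V] {G : SimpleGraph V}

variable (G) in
/-- The contribution of a blow-up to the expansion in the `p̄'_λ`. -/
noncomputable def coefficient (t : Blowup) : Coeff :=
  t.weight • t.base.signedWeight • pyramidPoly G t.base

/-- A monomial of degree D occurs in p̄'_λ only if |λ| ≤ D. That leaves finitely many partitions,
each with finitely many blow-ups, and this licenses the regrouping by partition. -/
theorem summable_coefficient : Summable fun t : Blowup => coefficient G t • mpbar t.list := by
  rw [WithPiTopology.summable_iff_summable_coeff]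
  intro m
  have hfin : (⋃ n ∈ Finset.range (m.degree + 1), ⋃ l ∈ {l : IntPartition | l.size = n},
      fiber l).Finite :=
    Set.Finite.biUnion (Finset.finite_toSet _) fun n _ =>
      Set.Finite.biUnion (finite_size_eq n) fun l _ => fiber_finite l
  refine summable_of_hasFiniteSupport (hfin.subset fun t ht => ?_)
  simp only [Set.mem_iUnion]
  refine ⟨t.partition.size, ?_, t.partition, rfl, (mem_fiber_iff t _).2 rfl⟩
  rw [Finset.mem_range, Nat.lt_succ_iff]
  by_contra hlt
  refine ht ?_
  change coeff m (_ • _) = 0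
  rw [coeff_smul, coeff_mpbar_eq_zero, mul_zero]
  rw [IntPartition.size_eq, partition, Equiv.apply_symm_apply] at hlt
  exact not_le.1 hlt

variable [Fintype V]

/-- Multiplying out the expanded logarithms means choosing a pair (d_i, n_i) for each part of λ',
that is, a blow-up of λ'. -/
theorem hasSum_coefficient (hG : SeparatesNeighbours G) :
    HasSum (fun t : Blowup => coefficient G t • mpbar t.list) (kromaticQ G) := by
  rw [← equivSigma.symm.hasSum_iff]
  refine HasSum.sigma_of_hasSum (hasSum_kromaticQ hG) (fun l => ?_)
    (equivSigma.symm.summable_iff.2 summable_coefficient)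
  have h := (hasSum_prod_fin fun i => hasSum_moebiusLog (l.part i)).mul_left
    (C (l.signedWeight • pyramidPoly G l))
  rw [← smul_eq_C_mul] at h
  refine (congrArg (HasSum · _) (funext fun x => ?_)).mp h
  rw [Function.comp_apply, mpbar_list, Finset.prod_smul, coefficient, ← smul_eq_C_mul, smul_comm]
  exact (smul_assoc _ _ _).symm

theorem hasSum_pbar (hG : SeparatesNeighbours G) :
    HasSum (fun l : IntPartition => (∑ᶠ t ∈ fiber l, coefficient G t) • l.pbar)
      (kromaticQ G) := by
  have h := (Equiv.sigmaFiberEquiv partition).hasSum_iff.2 (hasSum_coefficient hG)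
  refine h.sigma fun l => ?_
  have hfib : fiber l = {t | t.partition = l} := Set.ext fun t => mem_fiber_iff t l
  have hl : ∀ t : {t : Blowup // t.partition = l}, l.pbar = mpbar t.1.list := by
    rintro ⟨t, rfl⟩
    rw [IntPartition.pbar_eq]
    exact congrArg mpbar (Equiv.apply_symm_apply _ _)
  have hfin : (fiber l).Finite := fiber_finite l
  rw [hfib] at hfin
  have : Fintype {t : Blowup // t.partition = l} := hfin.fintype
  have hc : ∑ᶠ t ∈ fiber l, coefficient G t =
      ∑ t : {t : Blowup // t.partition = l}, coefficient G t.1 := by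
    rw [hfib, ← finsum_set_coe_eq_finsum_mem]
    exact finsum_eq_sum_of_fintype (α := {t : Blowup // t.partition = l}) _
  rw [hc, Finset.sum_smul]
  refine (congrArg (HasSum _) (Finset.sum_congr rfl fun t _ => ?_)).mp (hasSum_fintype _)
  rw [hl t]
  rfl

end Blowup

end Existence

end Kromatic

theorem proposition5p2 {V : Type*} [Fintype V] [LinearOrder V]
    (r : V → V → Prop) [IsPartialOrder V r]
    (hr : Kromatic.IsUnitIntervalOrder r) (hnat : Kromatic.IsNaturalLabelling r)
    (G : SimpleGraph V) (hG : G = Kromatic.incompGraph r) :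
    HasSum
      (fun l : Kromatic.IntPartition =>
        (l.signedWeight • Kromatic.pyramidPoly G l) •
          ∏ i : Fin l.length, Kromatic.moebiusLog (l.part i))
      (Kromatic.kromaticQ G) ∧
    ∀ c : Kromatic.IntPartition → Kromatic.Coeff,
      HasSum (fun l : Kromatic.IntPartition => c l • l.pbar) (Kromatic.kromaticQ G) ↔
        ∀ l : Kromatic.IntPartition,
          c l = ∑ᶠ t ∈ Kromatic.Blowup.fiber l,
            t.weight • t.base.signedWeight • Kromatic.pyramidPoly G t.base := by
  have hsep : Kromatic.SeparatesNeighbours G :=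
    hG ▸ Kromatic.separatesNeighbours_of_isNaturalLabelling r hnat
  refine ⟨Kromatic.hasSum_kromaticQ hsep, fun c => ⟨fun h l => ?_, fun h => ?_⟩⟩
  · exact congrFun (Kromatic.hasSum_pbar_unique h (Kromatic.Blowup.hasSum_pbar hsep)) l
  · rw [funext h]
    exact Kromatic.Blowup.hasSum_pbar hsep
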